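/- Let $h$ be the Klein metric on the unit disk $\mathbb D^2\subset\mathbb R^2$, with norm $$\Phi(\mathbf y)=\sqrt{h(\mathbf y,\mathbf y)}=\frac{\sqrt{u^2+v^2-(xv-yu)^2}}{1-x^2-y^2},\qquad \mathbf y=(u,v)\in T_{(x,y)}\mathbb D^2,$$ let $\mathbf v_{(x,y)}=(-y,x)$ be the rotation field, let $\epsilon\in\mathbb R$ and let $\mathbb D^2(\rho)$ be the open disk of radius $\rho=1/\sqrt{1+\epsilon^2}$ centred at the origin. For every $p\in\mathbb D^2(\rho)$ and $0\neq\mathbf y\in T_p\mathbb D^2(\rho)$ the equation $\Phi\big(\mathbf y/F(\mathbf y)-\epsilon\mathbf v_p\big)=1$ has exactly one positive solution $F(\mathbf y)$. It is $F=\alpha+\beta$ with $$\alpha(\mathbf y)=\frac{\sqrt{\epsilon^2h(\mathbf v,\mathbf y)^2+h(\mathbf y,\mathbf y)\big(1-\epsilon^2h(\mathbf v,\mathbf v)\big)}}{1-\epsilon^2h(\mathbf v,\mathbf v)},\qquad \beta(\mathbf y)=-\frac{\epsilon\,h(\mathbf v,\mathbf y)}{1-\epsilon^2h(\mathbf v,\mathbf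 v)} .$$ With $F(0)=0$, $F$ is a Finsler metric on $\mathbb D^2(\rho)$, and it is a Randers metric: $\alpha$ is the norm of a smooth Riemannian metric and $\beta$ is a smooth 1-form with $\sup_{\mathbf y\ne0}\beta(\mathbf y)/\alpha(\mathbf y)<1$ at each point. Moreover: (a) $F$ has constant flag curvature $\mathbf K=-1$, that is, $R^i_{\ k}=-\{F^2\delta^i_k-FF_{y^k}y^i\}$, where $R^i_{\ k}$ is the Riemann curvature of $F$. (b) The S-curvature of $F$, taken with respect to its Busemann-Hausdorff volume form, vanishes: $\mathbf S=0$. (c) If $\epsilon\neq0$, then $F$ is not locally projectively flat; that is, it is not true that every point of $\mathbb D^2(\rho)$ has a smooth local coordinate system around it in which the geodesics of $F$ are straight lines as point sets. (d) If $\epsilon\ne0$, then the Gauss curvature $\bar{\mathbf K}$ of $\alpha$ is not constant on $\mathbb D^2(\rho)$. If $\epsilon=0$, then $\bar{\mathbf K}=-1$. -/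

import Mathlib

open scoped ContDiff

noncomputable section

namespace Finsler

/-- Coordinate space `ℝⁿ`, with its Euclidean norm. -/
abbrev Coord (n : ℕ) : Type := EuclideanSpace ℝ (Fin n)

variable {n : ℕ}

/-- The coordinate vector `e i`. -/
def e (i : Fin n) : Coord n := EuclideanSpace.single i 1

/-- The partial derivative of `f` at `x` in the `i`-th coordinate. -/
def pd (f : Coord n → ℝ) (i : Fin n) (x : Coord n) : ℝ := fderiv ℝ f x (e i)

/-- The fundamental tensor: half the Hessian of `F ^ 2` in the vector variable `y`. -/
def fundTensor (F : Coord n → Coord n → ℝ) (x y : Coord n) : Matrix (Fin n) (Fin n) ℝ :=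
  Matrix.of fun i j => (1 / 2) * pd (fun z => pd (fun w => F x w ^ 2) i z) j y

/-- `F` is a Finsler metric on the open set `U` of `ℝⁿ`. -/
structure IsFinslerOn (U : Set (Coord n)) (F : Coord n → Coord n → ℝ) : Prop where
  smooth : ContDiffOn ℝ ∞ (fun z : Coord n × Coord n => F z.1 z.2) (U ×ˢ {y | y ≠ 0})
  zero : ∀ x ∈ U, F x 0 = 0
  pos : ∀ x ∈ U, ∀ y, y ≠ 0 → 0 < F x y
  homog : ∀ x ∈ U, ∀ y, ∀ t : ℝ, 0 < t → F x (t • y) = t * F x y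
  convex : ∀ x ∈ U, ∀ y, y ≠ 0 → ∀ u : Coord n, u ≠ 0 →
    0 < ∑ i, ∑ j, fundTensor F x y i j * u i * u j

/-- The geodesic (spray) coefficients
`G^i = (1/4) g^{ik} (2 ∂g_{pk}/∂x^q - ∂g_{pq}/∂x^k) y^p y^q`. -/
def spray (F : Coord n → Coord n → ℝ) (x y : Coord n) (i : Fin n) : ℝ :=
  (1 / 4) * ∑ k, (fundTensor F x y)⁻¹ i k * ∑ p, ∑ q,
    (2 * pd (fun x' => fundTensor F x' y p k) q x - pd (fun x' => fundTensor F x' y p q) k x)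
      * y p * y q

/-- The Riemann curvature
`R^i_k = 2 ∂G^i/∂x^k - y^j ∂²G^i/∂x^j∂y^k + 2 G^j ∂²G^i/∂y^j∂y^k - ∂G^i/∂y^j ∂G^j/∂y^k`. -/
def riemCurv (F : Coord n → Coord n → ℝ) (x y : Coord n) (i k : Fin n) : ℝ :=
  2 * pd (fun x' => spray F x' y i) k x
    - ∑ j, y j * pd (fun x' => pd (fun y' => spray F x' y' i) k y) j x
    + 2 * ∑ j, spray F x y j * pd (fun z => pd (fun w => spray F x w i) k z) j y
    - ∑ j, pd (fun w => spray F x w i) j y * pd (fun w => spray F x w j) k y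

/-- `F` has constant (flag) curvature `K` on `U`:
`R^i_k = K (F² δ^i_k - F F_{y^k} y^i)` for all non-zero tangent vectors over `U`. -/
def HasConstCurvatureOn (U : Set (Coord n)) (F : Coord n → Coord n → ℝ) (K : ℝ) : Prop :=
  ∀ x ∈ U, ∀ y, y ≠ 0 → ∀ i k : Fin n,
    riemCurv F x y i k =
      K * (F x y ^ 2 * (if i = k then 1 else 0) - F x y * pd (fun w => F x w) k y * y i)

/-- The density `σ` of the Busemann-Hausdorff volume form `σ(x) dx¹ ⋯ dxⁿ` of `F`: the volume of
the Euclidean unit ball divided by the volume of the unit ball of `F` at `x`. -/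
def bhDensity (F : Coord n → Coord n → ℝ) (x : Coord n) : ℝ :=
  (MeasureTheory.volume (Metric.ball (0 : Coord n) 1)).toReal /
    (MeasureTheory.volume {y : Coord n | F x y < 1}).toReal

/-- The S-curvature `S = ∂G^i/∂y^i - (y^i / σ) ∂σ/∂x^i`. -/
def sCurv (F : Coord n → Coord n → ℝ) (x y : Coord n) : ℝ :=
  ∑ i, pd (fun w => spray F x w i) i y - ∑ i, y i / bhDensity F x * pd (bhDensity F) i x

/-- `c` is a (non-constant) geodesic of `F` in `V`, defined on the open interval `(s, t)`. -/
structure IsGeodesicIn (F : Coord n → Coord n → ℝ) (V : Set (Coord n)) (s t : ℝ)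
    (c : ℝ → Coord n) : Prop where
  smooth : ContDiffOn ℝ 2 c (Set.Ioo s t)
  mem : ∀ τ ∈ Set.Ioo s t, c τ ∈ V
  regular : ∀ τ ∈ Set.Ioo s t, deriv c τ ≠ 0
  eqn : ∀ τ ∈ Set.Ioo s t, ∀ i, deriv (deriv c) τ i + 2 * spray F (c τ) (deriv c τ) i = 0

/-- `F` is locally projectively flat on `U`: around every point of `U` there is a smooth
coordinate system in which all geodesics are (parts of) straight lines, as point sets. -/
def IsLocallyProjectivelyFlatOn (U : Set (Coord n)) (F : Coord n → Coord n → ℝ) : Prop :=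
  ∀ p ∈ U, ∃ φ : OpenPartialHomeomorph (Coord n) (Coord n),
    p ∈ φ.source ∧ φ.source ⊆ U ∧ ContDiffOn ℝ ∞ φ φ.source ∧ ContDiffOn ℝ ∞ φ.symm φ.target ∧
      ∀ (s t : ℝ) (c : ℝ → Coord n), IsGeodesicIn F φ.source s t c →
        Collinear ℝ ((fun τ => φ (c τ)) '' Set.Ioo s t)

/-- `α` is the norm of the smooth Riemannian metric on `U` with coefficients `a`. -/
structure IsRiemannianNormOn (U : Set (Coord n)) (a : Coord n → Matrix (Fin n) (Fin n) ℝ)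
    (α : Coord n → Coord n → ℝ) : Prop where
  smooth : ∀ i j, ContDiffOn ℝ ∞ (fun x => a x i j) U
  posDef : ∀ x ∈ U, (a x).PosDef
  eq_sqrt : ∀ x ∈ U, ∀ y, α x y = Real.sqrt (∑ i, ∑ j, a x i j * y i * y j)

/-- `F` is the Randers metric `α + β` on `U`, where `α` is the norm of the Riemannian metric with
coefficients `a`, and `β` is the smooth 1-form with coefficients `b`, whose norm with respect to
`α`, the supremum of `β / α`, is less than one at each point. -/
structure IsRandersOn (U : Set (Coord n)) (a : Coord n → Matrix (Fin n) (Fin n) ℝ)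
    (b : Coord n → Fin n → ℝ) (α β F : Coord n → Coord n → ℝ) : Prop where
  riemannian : IsRiemannianNormOn U a α
  smooth : ∀ i, ContDiffOn ℝ ∞ (fun x => b x i) U
  oneForm : ∀ x ∈ U, ∀ y, β x y = ∑ i, b x i * y i
  norm_lt_one : ∀ x ∈ U, ∃ k : ℝ, k < 1 ∧ ∀ y, β x y ≤ k * α x y
  eq_sum : ∀ x ∈ U, ∀ y, F x y = α x y + β x y

/-- The Christoffel symbols `Γ^k_{ij}` of a Riemannian metric with coefficients `a`. -/
def christoffel (a : Coord n → Matrix (Fin n) (Fin n) ℝ) (k i j : Fin n) (x : Coord n) : ℝ :=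
  (1 / 2) * ∑ l, (a x)⁻¹ k l *
    (pd (fun x' => a x' j l) i x + pd (fun x' => a x' i l) j x - pd (fun x' => a x' i j) l x)

/-- The curvature tensor: `R(∂_i, ∂_j) ∂_k = ∑ l, (curvTensor a l k i j) ∂_l`. -/
def curvTensor (a : Coord n → Matrix (Fin n) (Fin n) ℝ) (l k i j : Fin n) (x : Coord n) : ℝ :=
  pd (christoffel a l j k) i x - pd (christoffel a l i k) j x
    + ∑ m, (christoffel a l i m x * christoffel a m j k x
      - christoffel a l j m x * christoffel a m i k x)

/-- The Gauss curvature `⟨R(∂_1, ∂_2) ∂_2, ∂_1⟩ / det a` of a surface metric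
(coordinates are numbered `0, 1` here). -/
def gaussCurv (a : Coord 2 → Matrix (Fin 2) (Fin 2) ℝ) (x : Coord 2) : ℝ :=
  (∑ l, a x 0 l * curvTensor a l 1 0 1 x) / (a x).det

/-- The Klein metric on the unit disk, as an inner product on the tangent space at `p`. Its norm is
`√(|w|² - (p₁w₂ - p₂w₁)²) / (1 - |p|²)`. -/
def klein (p w z : Coord 2) : ℝ :=
  ((w 0 * z 0 + w 1 * z 1) - (p 0 * w 1 - p 1 * w 0) * (p 0 * z 1 - p 1 * z 0)) /
    (1 - (p 0 ^ 2 + p 1 ^ 2)) ^ 2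

/-- The norm `Φ` of the Klein metric. -/
def kleinNorm (p w : Coord 2) : ℝ := Real.sqrt (klein p w w)

/-- The rotation field `(-y, x)` at the point `(x, y)`. -/
def rot (p : Coord 2) : Coord 2 := !₂[-(p 1), p 0]

/-- The Riemannian part `α`, as a function on tangent vectors. -/
def alpha (ε : ℝ) (p w : Coord 2) : ℝ :=
  Real.sqrt (ε ^ 2 * klein p (rot p) w ^ 2 + klein p w w * (1 - ε ^ 2 * klein p (rot p) (rot p))) /
    (1 - ε ^ 2 * klein p (rot p) (rot p))

/-- The 1-form `β`, as a function on tangent vectors. -/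
def beta (ε : ℝ) (p w : Coord 2) : ℝ :=
  -(ε * klein p (rot p) w / (1 - ε ^ 2 * klein p (rot p) (rot p)))

/-- The coefficients of the Riemannian metric whose norm is `α`. -/
def alphaCoeff (ε : ℝ) (p : Coord 2) : Matrix (Fin 2) (Fin 2) ℝ :=
  Matrix.of fun i j =>
    (ε ^ 2 * klein p (rot p) (e i) * klein p (rot p) (e j)
      + klein p (e i) (e j) * (1 - ε ^ 2 * klein p (rot p) (rot p))) /
    (1 - ε ^ 2 * klein p (rot p) (rot p)) ^ 2

/-- The coefficients of the 1-form `β`. -/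
def betaCoeff (ε : ℝ) (p : Coord 2) (i : Fin 2) : ℝ := beta ε p (e i)

/-- The metric `F = α + β`. -/
def randers (ε : ℝ) (p w : Coord 2) : ℝ := alpha ε p w + beta ε p w

/-- The open disk of radius `1 / √(1 + ε²)`. -/
def disk (ε : ℝ) : Set (Coord 2) := Metric.ball 0 (1 / Real.sqrt (1 + ε ^ 2))

end Finsler

end

/-! This is Zermelo navigation on the hyperbolic plane: the indicatrix of F at p is the Klein unit
circle translated by εv, and v generates rotations, which are Klein isometries. Hence unit-speed
geodesics of F should be Klein geodesics carried along by the rotation through angle εt.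
Transporting the Klein geodesic equation in this way and homogenising in y suggests the spray G = P
y - εF (rot y + P rot x) - (ε²/2) F² x, with P = ⟨x, y⟩ / (1 - |x|²). The proof does not formalise
the flow argument; it verifies this formula.

Two devices keep the verification algebraic. First, F is handled through the quadratic equation
`randers_quadratic`, whose implicit differentiation gives its first derivatives without square
roots. Second, `IsSprayOn.spray_eq` recognises a spray from 2-homogeneity and the first-order
equations F_{x^k} = G^j_{y^k} F_{y^j}, so the fundamental tensor is never inverted explicitly.
Contracting and differentiating those equations also removes every second derivative of F from the
curvature, which leaves polynomial identities for (a).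

For (b), translation preserves area, so the Busemann-Hausdorff density is that of the Klein metric,
(1 - |x|²)^(-3/2), whose logarithmic derivative along y is 3P. The divergence of G is also 3P,
because the vector multiplying dF in it is tangent to the indicatrix (`randers_dY_rotational`).

For (c), the geodesics leaving the origin in opposite directions are spirals. Two of them share a
tangent line there but trace distinct curves, mirror images of each other; a chart straightening
both would send them into one line and so would have a singular differential.

For (d), the Gauss curvature of α is computed in closed form from its Christoffel symbols; it is a
function of |x|² that is constant only for ε = 0. -/

open scoped ContDiff
open Filter Topology

noncomputable section

namespace Finsler

/-! ### Partial derivatives in the position and vector variables -/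

section

variable {n : ℕ}

/-- `f` is differentiable at `x`, and its `i`-th partial derivative there is `f'`. -/
structure HasPd (f : Coord n → ℝ) (i : Fin n) (f' : ℝ) (x : Coord n) : Prop where
  diff : DifferentiableAt ℝ f x
  eq : pd f i x = f'

namespace HasPd

variable {f g : Coord n → ℝ} {i : Fin n} {f' g' : ℝ} {x : Coord n}

theorem congr_val (h : HasPd f i f' x) (hv : f' = g') : HasPd f i g' x := hv ▸ h

theorem of_diff (h : DifferentiableAt ℝ f x) : HasPd f i (pd f i x) x := ⟨h, rfl⟩

theorem congr (h : HasPd f i f' x) (hfg : f =ᶠ[𝓝 x] g) : HasPd g i f' x :=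
  ⟨h.diff.congr_of_eventuallyEq hfg.symm, by rw [← h.eq]; simp only [pd]; rw [hfg.fderiv_eq]⟩

theorem unique (h : HasPd f i f' x) (h' : HasPd f i g' x) : f' = g' := h.eq.symm.trans h'.eq

theorem const (c : ℝ) : HasPd (fun _ : Coord n => c) i 0 x := ⟨by fun_prop, by simp [pd]⟩

theorem coord (j : Fin n) : HasPd (fun x : Coord n => x j) i (if j = i then 1 else 0) x := by
  refine ⟨by fun_prop, ?_⟩
  have : HasFDerivAt (fun x : Coord n => x j) (EuclideanSpace.proj j : Coord n →L[ℝ] ℝ) x :=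
    (EuclideanSpace.proj j : Coord n →L[ℝ] ℝ).hasFDerivAt
  simp [pd, this.fderiv, e, eq_comm]

theorem add (hf : HasPd f i f' x) (hg : HasPd g i g' x) :
    HasPd (fun x => f x + g x) i (f' + g') x :=
  ⟨hf.diff.add hg.diff, by
    rw [← hf.eq, ← hg.eq]; simp only [pd]; rw [fderiv_fun_add hf.diff hg.diff]; rfl⟩

theorem neg (hf : HasPd f i f' x) : HasPd (fun x => -f x) i (-f') x :=
  ⟨hf.diff.neg, by rw [← hf.eq]; simp only [pd]; rw [fderiv_fun_neg]; rfl⟩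

theorem sub (hf : HasPd f i f' x) (hg : HasPd g i g' x) :
    HasPd (fun x => f x - g x) i (f' - g') x :=
  ⟨hf.diff.sub hg.diff, by
    rw [← hf.eq, ← hg.eq]; simp only [pd]; rw [fderiv_fun_sub hf.diff hg.diff]; rfl⟩

theorem mul (hf : HasPd f i f' x) (hg : HasPd g i g' x) :
    HasPd (fun x => f x * g x) i (f' * g x + f x * g') x :=
  ⟨hf.diff.mul hg.diff, by
    rw [← hf.eq, ← hg.eq]; simp only [pd]; rw [fderiv_fun_mul hf.diff hg.diff]
    simp [mul_comm, add_comm]⟩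

theorem comp {φ : ℝ → ℝ} {φ' : ℝ} (hf : HasPd f i f' x) (hφ : HasDerivAt φ φ' (f x)) :
    HasPd (fun x => φ (f x)) i (φ' * f') x :=
  ⟨hφ.differentiableAt.comp x hf.diff, by
    rw [← hf.eq]; simp only [pd]
    have := hφ.comp_hasFDerivAt x hf.diff.hasFDerivAt
    rw [show (fun x => φ (f x)) = φ ∘ f from rfl, this.fderiv]; simp⟩

theorem const_mul (c : ℝ) (hf : HasPd f i f' x) : HasPd (fun x => c * f x) i (c * f') x :=
  ((HasPd.const c).mul hf).congr_val (by ring)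

theorem sq (hf : HasPd f i f' x) : HasPd (fun x => f x ^ 2) i (2 * f x * f') x :=
  (hf.comp (hasDerivAt_pow 2 (f x))).congr_val (by norm_num)

theorem inv (hf : HasPd f i f' x) (h : f x ≠ 0) :
    HasPd (fun x => (f x)⁻¹) i (-f' / f x ^ 2) x :=
  (hf.comp (hasDerivAt_inv h)).congr_val (by ring)

theorem div (hf : HasPd f i f' x) (hg : HasPd g i g' x) (h : g x ≠ 0) :
    HasPd (fun x => f x / g x) i ((f' * g x - f x * g') / g x ^ 2) x := by
  simp only [div_eq_mul_inv]
  exact (hf.mul (hg.inv h)).congr_val (by field_simp; ring)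

theorem sqrt (hf : HasPd f i f' x) (h : 0 < f x) :
    HasPd (fun x => Real.sqrt (f x)) i (f' / (2 * Real.sqrt (f x))) x :=
  (hf.comp (Real.hasDerivAt_sqrt h.ne')).congr_val (by ring)

theorem sum {ι : Type*} {s : Finset ι} {f : ι → Coord n → ℝ} {f' : ι → ℝ}
    (h : ∀ j ∈ s, HasPd (f j) i (f' j) x) :
    HasPd (fun x => ∑ j ∈ s, f j x) i (∑ j ∈ s, f' j) x := by
  classical
  induction s using Finset.induction_on with
  | empty => simpa using HasPd.const (i := i) (x := x) (0 : ℝ)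
  | insert a s ha ih =>
    simp only [Finset.sum_insert ha]
    exact (h a (by simp)).add (ih fun j hj => h j (by simp [hj]))

end HasPd

theorem sum_smul_e (y : Coord n) : ∑ k, y k • e k = y := by
  ext i
  simp [e, Pi.single_apply]

theorem fderiv_apply_eq_sum_pd (f : Coord n → ℝ) (x y : Coord n) :
    fderiv ℝ f x y = ∑ k, y k * pd f k x := by
  conv_lhs => rw [← sum_smul_e y]
  simp [pd]

/-- Partial derivative in the position variable. -/
def dX (F : Coord n → Coord n → ℝ) (k : Fin n) (x y : Coord n) : ℝ := pd (fun x' => F x' y) k x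

/-- Partial derivative in the vector variable. -/
def dY (F : Coord n → Coord n → ℝ) (k : Fin n) (x y : Coord n) : ℝ := pd (fun y' => F x y') k y

/-- Joint smoothness on a set. -/
abbrev SmoothOn (F : Coord n → Coord n → ℝ) (Ω : Set (Coord n × Coord n)) : Prop :=
  ContDiffOn ℝ ∞ (fun z : Coord n × Coord n => F z.1 z.2) Ω

section Joint

variable {F : Coord n → Coord n → ℝ} {Ω : Set (Coord n × Coord n)} {x y : Coord n}

theorem SmoothOn.contDiffAt (hF : SmoothOn F Ω) (hΩ : IsOpen Ω) (h : (x, y) ∈ Ω) :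
    ContDiffAt ℝ ∞ (fun z : Coord n × Coord n => F z.1 z.2) (x, y) :=
  ContDiffOn.contDiffAt hF (hΩ.mem_nhds h)

theorem SmoothOn.differentiableAt (hF : SmoothOn F Ω) (hΩ : IsOpen Ω) (h : (x, y) ∈ Ω) :
    DifferentiableAt ℝ (fun z : Coord n × Coord n => F z.1 z.2) (x, y) :=
  (hF.contDiffAt hΩ h).differentiableAt (by simp)

theorem SmoothOn.hasFDerivAt_left (hF : SmoothOn F Ω) (hΩ : IsOpen Ω) (h : (x, y) ∈ Ω) :
    HasFDerivAt (fun x' => F x' y) ((fderiv ℝ (fun z : Coord n × Coord n => F z.1 z.2) (x, y)).comp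
      (ContinuousLinearMap.inl ℝ (Coord n) (Coord n))) x :=
  HasFDerivAt.comp (g := fun z : Coord n × Coord n => F z.1 z.2) (f := fun x' => (x', y)) x
    (hF.differentiableAt hΩ h).hasFDerivAt (hasFDerivAt_prodMk_left x y)

theorem SmoothOn.hasFDerivAt_right (hF : SmoothOn F Ω) (hΩ : IsOpen Ω) (h : (x, y) ∈ Ω) :
    HasFDerivAt (fun y' => F x y') ((fderiv ℝ (fun z : Coord n × Coord n => F z.1 z.2) (x, y)).comp
      (ContinuousLinearMap.inr ℝ (Coord n) (Coord n))) y :=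
  HasFDerivAt.comp (g := fun z : Coord n × Coord n => F z.1 z.2) (f := fun y' => (x, y')) y
    (hF.differentiableAt hΩ h).hasFDerivAt (hasFDerivAt_prodMk_right x y)

theorem SmoothOn.hasPd_left (hF : SmoothOn F Ω) (hΩ : IsOpen Ω) (h : (x, y) ∈ Ω) (k : Fin n) :
    HasPd (fun x' => F x' y) k (dX F k x y) x :=
  HasPd.of_diff (hF.hasFDerivAt_left hΩ h).differentiableAt

theorem SmoothOn.hasPd_right (hF : SmoothOn F Ω) (hΩ : IsOpen Ω) (h : (x, y) ∈ Ω) (k : Fin n) :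
    HasPd (fun y' => F x y') k (dY F k x y) y :=
  HasPd.of_diff (hF.hasFDerivAt_right hΩ h).differentiableAt

/-- Reading a partial derivative as the total derivative in a fixed direction is what transfers
joint smoothness and the symmetry of second derivatives to `dX` and `dY`. -/
theorem SmoothOn.dX_eq (hF : SmoothOn F Ω) (hΩ : IsOpen Ω) (h : (x, y) ∈ Ω) (k : Fin n) :
    dX F k x y = fderiv ℝ (fun z : Coord n × Coord n => F z.1 z.2) (x, y) (e k, 0) := by
  simp [dX, pd, (hF.hasFDerivAt_left hΩ h).fderiv]

theorem SmoothOn.dY_eq (hF : SmoothOn F Ω) (hΩ : IsOpen Ω) (h : (x, y) ∈ Ω) (k : Fin n) :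
    dY F k x y = fderiv ℝ (fun z : Coord n × Coord n => F z.1 z.2) (x, y) (0, e k) := by
  simp [dY, pd, (hF.hasFDerivAt_right hΩ h).fderiv]

theorem SmoothOn.fderiv_apply (hF : SmoothOn F Ω) (hΩ : IsOpen Ω) (v : Coord n × Coord n) :
    ContDiffOn ℝ ∞ (fun p => fderiv ℝ (fun z : Coord n × Coord n => F z.1 z.2) p v) Ω :=
  (hF.fderiv_of_isOpen hΩ (by simp)).clm_apply contDiffOn_const

theorem SmoothOn.dX_smooth (hF : SmoothOn F Ω) (hΩ : IsOpen Ω) (k : Fin n) : SmoothOn (dX F k) Ω :=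
  (hF.fderiv_apply hΩ (e k, 0)).congr fun z hz => hF.dX_eq (x := z.1) (y := z.2) hΩ hz k

theorem SmoothOn.dY_smooth (hF : SmoothOn F Ω) (hΩ : IsOpen Ω) (k : Fin n) : SmoothOn (dY F k) Ω :=
  (hF.fderiv_apply hΩ (0, e k)).congr fun z hz => hF.dY_eq (x := z.1) (y := z.2) hΩ hz k

theorem SmoothOn.fderiv_fderiv_symm (hF : SmoothOn F Ω) (hΩ : IsOpen Ω) (h : (x, y) ∈ Ω)
    (v w : Coord n × Coord n) :
    fderiv ℝ (fun p => fderiv ℝ (fun z : Coord n × Coord n => F z.1 z.2) p v) (x, y) w =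
      fderiv ℝ (fun p => fderiv ℝ (fun z : Coord n × Coord n => F z.1 z.2) p w) (x, y) v := by
  have hd : DifferentiableAt ℝ (fderiv ℝ (fun z : Coord n × Coord n => F z.1 z.2)) (x, y) :=
    ((hF.fderiv_of_isOpen (m := ∞) hΩ (by simp)).contDiffAt (hΩ.mem_nhds h)).differentiableAt
      (by simp)
  have hs : IsSymmSndFDerivAt ℝ (fun z : Coord n × Coord n => F z.1 z.2) (x, y) :=
    (hF.contDiffAt hΩ h).isSymmSndFDerivAt (by
      simp only [minSmoothness_of_isRCLikeNormedField]
      exact WithTop.coe_le_coe.2 (le_top : (2 : ℕ∞) ≤ ⊤))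
  rw [fderiv_clm_apply hd (by fun_prop), fderiv_clm_apply hd (by fun_prop)]
  simpa using hs w v

theorem fderiv_congr_of_mem {f g : Coord n × Coord n → ℝ} {p : Coord n × Coord n}
    (hΩ : IsOpen Ω) (h : p ∈ Ω) (hfg : ∀ z ∈ Ω, f z = g z) : fderiv ℝ f p = fderiv ℝ g p :=
  (eventuallyEq_of_mem (hΩ.mem_nhds h) hfg).fderiv_eq

theorem SmoothOn.dX_dY (hF : SmoothOn F Ω) (hΩ : IsOpen Ω) (h : (x, y) ∈ Ω) (j k : Fin n) :
    dX (dY F j) k x y = dY (dX F k) j x y := by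
  rw [(hF.dY_smooth hΩ j).dX_eq hΩ h, (hF.dX_smooth hΩ k).dY_eq hΩ h,
    fderiv_congr_of_mem hΩ h (fun z hz => hF.dY_eq (x := z.1) (y := z.2) hΩ hz j),
    fderiv_congr_of_mem hΩ h (fun z hz => hF.dX_eq (x := z.1) (y := z.2) hΩ hz k)]
  exact hF.fderiv_fderiv_symm hΩ h _ _

theorem SmoothOn.dY_dY (hF : SmoothOn F Ω) (hΩ : IsOpen Ω) (h : (x, y) ∈ Ω) (j k : Fin n) :
    dY (dY F j) k x y = dY (dY F k) j x y := by
  rw [(hF.dY_smooth hΩ j).dY_eq hΩ h, (hF.dY_smooth hΩ k).dY_eq hΩ h,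
    fderiv_congr_of_mem hΩ h (fun z hz => hF.dY_eq (x := z.1) (y := z.2) hΩ hz j),
    fderiv_congr_of_mem hΩ h (fun z hz => hF.dY_eq (x := z.1) (y := z.2) hΩ hz k)]
  exact hF.fderiv_fderiv_symm hΩ h _ _

theorem eventually_left (hΩ : IsOpen Ω) (h : (x, y) ∈ Ω) : ∀ᶠ x' in 𝓝 x, (x', y) ∈ Ω :=
  (Continuous.prodMk_left y).continuousAt.eventually (hΩ.mem_nhds h)

theorem eventually_right (hΩ : IsOpen Ω) (h : (x, y) ∈ Ω) : ∀ᶠ y' in 𝓝 y, (x, y') ∈ Ω :=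
  (Continuous.prodMk_right x).continuousAt.eventually (hΩ.mem_nhds h)

theorem dX_congr {G : Coord n → Coord n → ℝ} (hΩ : IsOpen Ω) (h : (x, y) ∈ Ω)
    (hFG : ∀ x y, (x, y) ∈ Ω → F x y = G x y) (k : Fin n) : dX F k x y = dX G k x y := by
  simp only [dX, pd]
  rw [EventuallyEq.fderiv_eq ((eventually_left hΩ h).mono fun x' hx' => hFG x' y hx')]

theorem dY_congr {G : Coord n → Coord n → ℝ} (hΩ : IsOpen Ω) (h : (x, y) ∈ Ω)
    (hFG : ∀ x y, (x, y) ∈ Ω → F x y = G x y) (k : Fin n) : dY F k x y = dY G k x y := by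
  simp only [dY, pd]
  rw [EventuallyEq.fderiv_eq ((eventually_right hΩ h).mono fun y' hy' => hFG x y' hy')]

end Joint

/-- The slit tangent bundle over `U`. -/
abbrev slit (U : Set (Coord n)) : Set (Coord n × Coord n) := U ×ˢ {y | y ≠ 0}

theorem isOpen_slit {U : Set (Coord n)} (hU : IsOpen U) : IsOpen (slit U) :=
  hU.prod isOpen_ne

/-! ### Recognising a spray from first-order equations -/

section Spray

variable {U : Set (Coord n)} {F : Coord n → Coord n → ℝ} {G : Fin n → Coord n → Coord n → ℝ}
  {x y : Coord n}

/-- Euler's relation: differentiate t ↦ F(x, t y) at t = 1 in two ways. -/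
theorem IsFinslerOn.euler (hF : IsFinslerOn U F) (hU : IsOpen U) (hx : x ∈ U) (hy : y ≠ 0) :
    ∑ k, y k * dY F k x y = F x y := by
  have hd := (SmoothOn.hasFDerivAt_right hF.smooth (isOpen_slit hU) ⟨hx, hy⟩).differentiableAt
  have h1 : HasDerivAt (fun t : ℝ => F x (t • y)) (fderiv ℝ (fun y' => F x y') y y) 1 := by
    have hl : HasDerivAt (fun t : ℝ => t • y) y 1 := by
      simpa using (hasDerivAt_id (1 : ℝ)).smul_const y
    have hd' : HasFDerivAt (fun y' => F x y') (fderiv ℝ (fun y' => F x y') y) ((1 : ℝ) • y) := by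
      rw [one_smul]; exact hd.hasFDerivAt
    exact hd'.comp_hasDerivAt (1 : ℝ) hl
  have h2 : HasDerivAt (fun t : ℝ => F x (t • y)) (F x y) 1 := by
    refine HasDerivAt.congr_of_eventuallyEq (f := fun t : ℝ => t * F x y) ?_ ?_
    · simpa using (hasDerivAt_id (1 : ℝ)).mul_const (F x y)
    · filter_upwards [lt_mem_nhds (zero_lt_one' ℝ)] with t ht using hF.homog x hx y t ht
  rw [h2.unique h1, fderiv_apply_eq_sum_pd]
  rfl

theorem IsFinslerOn.euler_dY (hF : IsFinslerOn U F) (hU : IsOpen U) (hx : x ∈ U) (hy : y ≠ 0)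
    (k : Fin n) : ∑ j, y j * dY (dY F k) j x y = 0 := by
  have hΩ := isOpen_slit hU
  have hm : (x, y) ∈ slit U := ⟨hx, hy⟩
  have hs : SmoothOn F (slit U) := hF.smooth
  have h1 : HasPd (fun y' => ∑ j, y' j * dY F j x y') k
      (∑ j, ((if j = k then 1 else 0) * dY F j x y + y j * dY (dY F j) k x y)) y :=
    HasPd.sum fun j _ => (HasPd.coord j).mul ((hs.dY_smooth hΩ j).hasPd_right hΩ hm k)
  have h2 := h1.congr (g := fun y' => F x y')
    ((eventually_right hΩ hm).mono fun y' hy' => hF.euler hU hx hy'.2)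
  have h3 := h2.unique (hs.hasPd_right hΩ hm k)
  simp only [Finset.sum_add_distrib, ite_mul, one_mul, zero_mul, Finset.sum_ite_eq',
    Finset.mem_univ, if_true, add_eq_left] at h3
  rw [← h3]
  exact Finset.sum_congr rfl fun j _ => by rw [hs.dY_dY hΩ hm]

theorem SmoothOn.fundTensor_eq (hs : SmoothOn F (slit U)) (hU : IsOpen U) (hx : x ∈ U) (hy : y ≠ 0)
    (i j : Fin n) :
    fundTensor F x y i j = dY F i x y * dY F j x y + F x y * dY (dY F i) j x y := by
  have hΩ := isOpen_slit hU
  have hm : (x, y) ∈ slit U := ⟨hx, hy⟩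
  have h1 : HasPd (fun z => pd (fun w => F x w ^ 2) i z) j
      ((2 * dY F j x y) * dY F i x y + (2 * F x y) * dY (dY F i) j x y) y := by
    refine HasPd.congr (((hs.hasPd_right hΩ hm j).const_mul 2).mul
      ((hs.dY_smooth hΩ i).hasPd_right hΩ hm j)) ?_
    exact (eventually_right hΩ hm).mono fun y' hy' => (hs.hasPd_right hΩ hy' i).sq.eq.symm
  simp only [fundTensor, Matrix.of_apply, h1.eq]
  ring

theorem IsFinslerOn.det_fundTensor_ne_zero (hF : IsFinslerOn U F) (hx : x ∈ U)
    (hy : y ≠ 0) : (fundTensor F x y).det ≠ 0 := by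
  intro h
  obtain ⟨v, hv, h0⟩ := Matrix.exists_mulVec_eq_zero_iff.mpr h
  have hp := hF.convex x hx y hy (WithLp.toLp 2 v) (by simpa using hv)
  have : ∑ i, ∑ j, fundTensor F x y i j * v i * v j = ∑ i, v i * (fundTensor F x y).mulVec v i := by
    refine Finset.sum_congr rfl fun i _ => ?_
    simp only [Matrix.mulVec, dotProduct, Finset.mul_sum]
    exact Finset.sum_congr rfl fun j _ => by ring
  simp [this, h0] at hp

/-- `G` satisfies the first-order equations that characterise the spray of `F`. -/
structure IsSprayOn (U : Set (Coord n)) (F : Coord n → Coord n → ℝ)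
    (G : Fin n → Coord n → Coord n → ℝ) : Prop where
  smooth : ∀ i, SmoothOn (G i) (slit U)
  euler : ∀ x ∈ U, ∀ y, y ≠ 0 → ∀ i, ∑ k, y k * dY (G i) k x y = 2 * G i x y
  horizontal : ∀ x ∈ U, ∀ y, y ≠ 0 → ∀ k, dX F k x y = ∑ j, dY (G j) k x y * dY F j x y

theorem IsSprayOn.dX_contract (hG : IsSprayOn U F G) (hx : x ∈ U) (hy : y ≠ 0) :
    ∑ k, y k * dX F k x y = 2 * ∑ j, G j x y * dY F j x y := by
  simp only [hG.horizontal x hx y hy, Finset.mul_sum]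
  rw [Finset.sum_comm]
  refine Finset.sum_congr rfl fun j _ => ?_
  rw [← mul_assoc, ← hG.euler x hx y hy j, Finset.sum_mul]
  exact Finset.sum_congr rfl fun k _ => by ring

/-- Differentiate y^j F_{x^j} = 2 G^j F_{y^j} in y^k; by the horizontal equation the term 2
G^j_{y^k} F_{y^j} is 2 F_{x^k}, one copy of which cancels. This is the Euler-Lagrange equation in
disguise, and it later eliminates the second derivatives of F from the curvature. -/
theorem IsSprayOn.dX_dY_contract (hG : IsSprayOn U F G) (hF : IsFinslerOn U F) (hU : IsOpen U)
    (hx : x ∈ U) (hy : y ≠ 0) (k : Fin n) :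
    ∑ j, y j * dX (dY F k) j x y = dX F k x y + 2 * ∑ j, G j x y * dY (dY F k) j x y := by
  have hΩ := isOpen_slit hU
  have hm : (x, y) ∈ slit U := ⟨hx, hy⟩
  have hs : SmoothOn F (slit U) := hF.smooth
  have h1 : HasPd (fun y' => ∑ j, y' j * dX F j x y') k
      (∑ j, ((if j = k then 1 else 0) * dX F j x y + y j * dY (dX F j) k x y)) y :=
    HasPd.sum fun j _ => (HasPd.coord j).mul ((hs.dX_smooth hΩ j).hasPd_right hΩ hm k)
  have h2 : HasPd (fun y' => 2 * ∑ j, G j x y' * dY F j x y') k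
      (2 * ∑ j, (dY (G j) k x y * dY F j x y + G j x y * dY (dY F j) k x y)) y :=
    (HasPd.sum fun j _ => ((hG.smooth j).hasPd_right hΩ hm k).mul
      ((hs.dY_smooth hΩ j).hasPd_right hΩ hm k)).const_mul 2
  have h3 := h1.unique (h2.congr
    ((eventually_right hΩ hm).mono fun y' hy' => (hG.dX_contract hx hy'.2).symm))
  simp only [Finset.sum_add_distrib, ite_mul, one_mul, zero_mul, Finset.sum_ite_eq',
    Finset.mem_univ, if_true, mul_add, ← hG.horizontal x hx y hy k] at h3
  have h4 : ∑ j, y j * dX (dY F k) j x y = ∑ j, y j * dY (dX F j) k x y :=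
    Finset.sum_congr rfl fun j _ => by rw [hs.dX_dY hΩ hm]
  have h5 : ∑ j, G j x y * dY (dY F k) j x y = ∑ j, G j x y * dY (dY F j) k x y :=
    Finset.sum_congr rfl fun j _ => by rw [hs.dY_dY hΩ hm]
  rw [h4, h5]
  linarith

theorem IsFinslerOn.fundTensor_contract (hF : IsFinslerOn U F) (hU : IsOpen U) (hx : x ∈ U)
    (hy : y ≠ 0) (k : Fin n) : ∑ p, fundTensor F x y p k * y p = F x y * dY F k x y := by
  have h1 := hF.euler hU hx hy
  have h2 := hF.euler_dY hU hx hy k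
  have hs : SmoothOn F (slit U) := hF.smooth
  simp only [hs.fundTensor_eq hU hx hy, hs.dY_dY (isOpen_slit hU) ⟨hx, hy⟩ _ k]
  calc _ = (∑ p, y p * dY F p x y) * dY F k x y + F x y * ∑ p, y p * dY (dY F k) p x y := by
        rw [Finset.sum_mul, Finset.mul_sum, ← Finset.sum_add_distrib]
        exact Finset.sum_congr rfl fun p _ => by ring
    _ = _ := by rw [h1, h2]; ring

theorem IsFinslerOn.fundTensor_contract₂ (hF : IsFinslerOn U F) (hU : IsOpen U) (hx : x ∈ U)
    (hy : y ≠ 0) : ∑ p, ∑ q, fundTensor F x y p q * y p * y q = F x y ^ 2 := by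
  rw [Finset.sum_comm]
  simp only [← Finset.sum_mul, hF.fundTensor_contract hU hx hy]
  rw [sq]
  conv_rhs => rw [← hF.euler hU hx hy, Finset.mul_sum, hF.euler hU hx hy]
  exact Finset.sum_congr rfl fun p _ => by ring

theorem IsFinslerOn.smoothOn_fundTensor (hF : IsFinslerOn U F) (hU : IsOpen U) (i j : Fin n) :
    SmoothOn (fun x y => fundTensor F x y i j) (slit U) := by
  have hs : SmoothOn F (slit U) := hF.smooth
  have hΩ := isOpen_slit hU
  refine ContDiffOn.congr (f := fun z => dY F i z.1 z.2 * dY F j z.1 z.2 +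
    F z.1 z.2 * dY (dY F i) j z.1 z.2) ?_ fun z hz => hs.fundTensor_eq hU hz.1 hz.2 i j
  exact (ContDiffOn.mul (hs.dY_smooth hΩ i) (hs.dY_smooth hΩ j)).add
    (ContDiffOn.mul hs ((hs.dY_smooth hΩ i).dY_smooth hΩ j))

/-- Homogeneity gives g_{pk} y^p = F F_{y^k} and g_{pq} y^p y^q = F². Differentiating these in x at
fixed y turns the bracket in the definition of `spray` into first and mixed derivatives of F. The
two contracted equations then identify it with 4 g_{kj} G^j, and positive definiteness lets the
matrix be cancelled. -/
theorem IsSprayOn.spray_eq (hG : IsSprayOn U F G) (hF : IsFinslerOn U F) (hU : IsOpen U)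
    (hx : x ∈ U) (hy : y ≠ 0) (i : Fin n) : spray F x y i = G i x y := by
  have hΩ := isOpen_slit hU
  have hm : (x, y) ∈ slit U := ⟨hx, hy⟩
  have hs : SmoothOn F (slit U) := hF.smooth
  have hg := fun i j => hF.smoothOn_fundTensor hU i j
  have h1 (q k : Fin n) : ∑ p, pd (fun x' => fundTensor F x' y p k) q x * y p
      = dX F q x y * dY F k x y + F x y * dX (dY F k) q x y := by
    have ha : HasPd (fun x' => ∑ p, fundTensor F x' y p k * y p) q
        (∑ p, (dX (fun x y => fundTensor F x y p k) q x y * y p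
          + fundTensor F x y p k * 0)) x :=
      HasPd.sum fun p _ => ((hg p k).hasPd_left hΩ hm q).mul (HasPd.const _)
    have hb := ((hs.hasPd_left hΩ hm q).mul ((hs.dY_smooth hΩ k).hasPd_left hΩ hm q)).congr
      ((eventually_left hΩ hm).mono fun x' hx' => (hF.fundTensor_contract hU hx'.1 hy k).symm)
    simpa [dX] using ha.unique hb
  have h2 (k : Fin n) : ∑ p, ∑ q, pd (fun x' => fundTensor F x' y p q) k x * y p * y q
      = 2 * F x y * dX F k x y := by
    have ha : HasPd (fun x' => ∑ p, ∑ q, fundTensor F x' y p q * y p * y q) k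
        (∑ p, ∑ q, ((dX (fun x y => fundTensor F x y p q) k x y * y p
          + fundTensor F x y p q * 0) * y q + (fundTensor F x y p q * y p) * 0)) x :=
      HasPd.sum fun p _ => HasPd.sum fun q _ => (((hg p q).hasPd_left hΩ hm k).mul
        (HasPd.const _)).mul (HasPd.const _)
    have hb := (hs.hasPd_left hΩ hm k).sq.congr
      ((eventually_left hΩ hm).mono fun x' hx' => (hF.fundTensor_contract₂ hU hx'.1 hy).symm)
    simpa [dX] using ha.unique hb
  have h3 (k : Fin n) : ∑ p, ∑ q, (2 * pd (fun x' => fundTensor F x' y p k) q x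
      - pd (fun x' => fundTensor F x' y p q) k x) * y p * y q
      = 4 * ∑ j, fundTensor F x y k j * G j x y := by
    have ha : ∑ p, ∑ q, (2 * pd (fun x' => fundTensor F x' y p k) q x
        - pd (fun x' => fundTensor F x' y p q) k x) * y p * y q
        = 2 * (∑ q, (∑ p, pd (fun x' => fundTensor F x' y p k) q x * y p) * y q)
          - ∑ p, ∑ q, pd (fun x' => fundTensor F x' y p q) k x * y p * y q := by
      simp only [Finset.sum_mul, Finset.mul_sum]
      rw [Finset.sum_comm (f := fun q p => 2 * (_ * _ * _)), ← Finset.sum_sub_distrib]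
      refine Finset.sum_congr rfl fun p _ => ?_
      rw [← Finset.sum_sub_distrib]
      exact Finset.sum_congr rfl fun q _ => by ring
    have hb : ∑ q, (dX F q x y * dY F k x y + F x y * dX (dY F k) q x y) * y q
        = (∑ q, y q * dX F q x y) * dY F k x y + F x y * ∑ q, y q * dX (dY F k) q x y := by
      rw [Finset.sum_mul, Finset.mul_sum, ← Finset.sum_add_distrib]
      exact Finset.sum_congr rfl fun q _ => by ring
    have hc : ∑ j, fundTensor F x y k j * G j x y = (∑ j, G j x y * dY F j x y) * dY F k x y
        + F x y * ∑ j, G j x y * dY (dY F k) j x y := by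
      rw [Finset.sum_mul, Finset.mul_sum, ← Finset.sum_add_distrib]
      exact Finset.sum_congr rfl fun j _ => by rw [hs.fundTensor_eq hU hx hy]; ring
    rw [ha, h2, hc]
    simp only [h1]
    rw [hb, hG.dX_contract hx hy, hG.dX_dY_contract hF hU hx hy k]
    ring
  have hdet : IsUnit (fundTensor F x y).det := (hF.det_fundTensor_ne_zero hx hy).isUnit
  have h4 : (fundTensor F x y)⁻¹.mulVec ((fundTensor F x y).mulVec fun j => G j x y) i
      = G i x y := by
    rw [Matrix.mulVec_mulVec, Matrix.nonsing_inv_mul _ hdet, Matrix.one_mulVec]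
  rw [← h4]
  simp only [spray, h3, Matrix.mulVec, dotProduct, Finset.mul_sum]
  exact Finset.sum_congr rfl fun k _ => Finset.sum_congr rfl fun j _ => by ring

theorem IsSprayOn.riemCurv_eq (hG : IsSprayOn U F G) (hF : IsFinslerOn U F) (hU : IsOpen U)
    (hx : x ∈ U) (hy : y ≠ 0) (i k : Fin n) :
    riemCurv F x y i k = 2 * dX (G i) k x y - ∑ j, y j * dX (dY (G i) k) j x y
      + 2 * ∑ j, G j x y * dY (dY (G i) k) j x y - ∑ j, dY (G i) j x y * dY (G j) k x y := by
  have hΩ := isOpen_slit hU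
  have hm : (x, y) ∈ slit U := ⟨hx, hy⟩
  have hG0 (i : Fin n) (x y : Coord n) (h : (x, y) ∈ slit U) : spray F x y i = G i x y :=
    hG.spray_eq hF hU h.1 h.2 i
  have hG1 (i k : Fin n) (x y : Coord n) (h : (x, y) ∈ slit U) :
      dY (fun x y => spray F x y i) k x y = dY (G i) k x y := dY_congr hΩ h (hG0 i) k
  have h1 := dX_congr hΩ hm (hG0 i) k
  have h2 (j : Fin n) := dX_congr hΩ hm (hG1 i k) j
  have h3 (j : Fin n) := dY_congr hΩ hm (hG1 i k) j
  have h4 (i j : Fin n) := hG1 i j x y hm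
  have h0 (j : Fin n) := hG0 j x y hm
  simp only [← h1, ← h2, ← h3, ← h4, ← h0]
  rfl

end Spray

end

/-! ### The navigation equation and closed forms of α, β and F -/

section

/-- `1 - |p|²`. -/
def qf (p : Coord 2) : ℝ := 1 - (p 0 ^ 2 + p 1 ^ 2)

/-- `1 - (1 + ε²) |p|²`. -/
def df (ε : ℝ) (p : Coord 2) : ℝ := 1 - (1 + ε ^ 2) * (p 0 ^ 2 + p 1 ^ 2)

/-- The quadratic form `(1 - |p|²) |y|² + ⟨p, y⟩²`. -/
def kq (p y : Coord 2) : ℝ := qf p * (y 0 ^ 2 + y 1 ^ 2) + (p 0 * y 0 + p 1 * y 1) ^ 2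

/-- The area form `p × y`. -/
def cr (p y : Coord 2) : ℝ := p 0 * y 1 - p 1 * y 0

/-- The quadratic form under the square root in `α`, rescaled. -/
def rad (ε : ℝ) (p y : Coord 2) : ℝ := ε ^ 2 * cr p y ^ 2 + df ε p * kq p y / qf p

variable {ε : ℝ} {p y : Coord 2}

@[simp] theorem rot_zero (p : Coord 2) : rot p 0 = -p 1 := by simp [rot]
@[simp] theorem rot_one (p : Coord 2) : rot p 1 = p 0 := by simp [rot]
@[simp] theorem e_apply {n : ℕ} (i j : Fin n) : e i j = if j = i then (1 : ℝ) else 0 := by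
  simp [e]

theorem mem_disk_iff : p ∈ disk ε ↔ 0 < df ε p := by
  have hc : (0 : ℝ) < 1 + ε ^ 2 := by positivity
  have h1 : ‖p‖ ^ 2 = p 0 ^ 2 + p 1 ^ 2 := by
    rw [EuclideanSpace.real_norm_sq_eq, Fin.sum_univ_two]
  have h2 : p ∈ disk ε ↔ ‖p‖ ^ 2 < (1 / Real.sqrt (1 + ε ^ 2)) ^ 2 := by
    rw [disk, mem_ball_zero_iff, sq_lt_sq₀ (norm_nonneg _) (by positivity)]
  rw [h2, h1, div_pow, Real.sq_sqrt hc.le, one_pow, lt_div_iff₀ hc, df, mul_comm]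
  constructor <;> intro h <;> linarith

theorem isOpen_disk (ε : ℝ) : IsOpen (disk ε) := Metric.isOpen_ball

theorem zero_mem_disk (ε : ℝ) : (0 : Coord 2) ∈ disk ε := by
  simp [mem_disk_iff, df]

theorem df_pos (hp : p ∈ disk ε) : 0 < df ε p := mem_disk_iff.mp hp

theorem qf_eq (ε : ℝ) (p : Coord 2) : qf p = df ε p + ε ^ 2 * (p 0 ^ 2 + p 1 ^ 2) := by
  simp only [qf, df]; ring

theorem qf_pos (hp : p ∈ disk ε) : 0 < qf p := by
  have := df_pos hp
  rw [qf_eq ε]; positivity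

theorem sq_add_sq_pos (hy : y ≠ 0) : 0 < y 0 ^ 2 + y 1 ^ 2 := by
  have h : 0 < ‖y‖ ^ 2 := by positivity
  rwa [EuclideanSpace.real_norm_sq_eq, Fin.sum_univ_two] at h

theorem kq_pos (hp : 0 < qf p) (hy : y ≠ 0) : 0 < kq p y := by
  have := sq_add_sq_pos hy
  unfold kq; positivity

theorem kq_nonneg (hp : 0 < qf p) : 0 ≤ kq p y := by
  unfold kq; positivity

theorem klein_self (p y : Coord 2) : klein p y y = kq p y / qf p ^ 2 := by
  simp only [klein, kq, qf]; congr 1; ring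

theorem klein_rot (hp : qf p ≠ 0) : klein p (rot p) y = cr p y / qf p := by
  have : klein p (rot p) y = (cr p y * qf p) / qf p ^ 2 := by
    simp only [klein, cr, qf, rot_zero, rot_one]; congr 1; ring
  rw [this]; field_simp

theorem cr_rot (p : Coord 2) : cr p (rot p) = p 0 ^ 2 + p 1 ^ 2 := by
  simp only [cr, rot_zero, rot_one]; ring

theorem one_sub_klein_rot (hp : qf p ≠ 0) :
    1 - ε ^ 2 * klein p (rot p) (rot p) = df ε p / qf p := by
  rw [klein_rot hp, cr_rot, eq_div_iff hp, sub_mul, one_mul, mul_assoc, div_mul_cancel₀ _ hp,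
    qf_eq ε]
  ring

theorem rad_pos (hp : p ∈ disk ε) (hy : y ≠ 0) : 0 < rad ε p y := by
  have := df_pos hp
  have := qf_pos hp
  have := kq_pos this hy
  unfold rad; positivity

theorem rad_nonneg (hp : p ∈ disk ε) : 0 ≤ rad ε p y := by
  have := df_pos hp
  have := qf_pos hp
  have := kq_nonneg (y := y) this
  unfold rad; positivity

theorem alpha_eq (hp : p ∈ disk ε) : alpha ε p y = Real.sqrt (rad ε p y) / df ε p := by
  have hq := qf_pos hp
  have hd := df_pos hp
  rw [alpha, one_sub_klein_rot hq.ne', klein_rot hq.ne', klein_self]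
  have : ε ^ 2 * (cr p y / qf p) ^ 2 + kq p y / qf p ^ 2 * (df ε p / qf p)
      = rad ε p y / qf p ^ 2 := by
    rw [rad]; field_simp
  rw [this, Real.sqrt_div (rad_nonneg hp), Real.sqrt_sq hq.le]
  field_simp

theorem beta_eq (hp : p ∈ disk ε) : beta ε p y = -(ε * cr p y / df ε p) := by
  have hq := qf_pos hp
  have hd := df_pos hp
  rw [beta, one_sub_klein_rot hq.ne', klein_rot hq.ne']
  field_simp

theorem randers_eq (hp : p ∈ disk ε) :
    randers ε p y = (Real.sqrt (rad ε p y) - ε * cr p y) / df ε p := by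
  rw [randers, alpha_eq hp, beta_eq hp]; ring

theorem randers_sqrt (hp : p ∈ disk ε) :
    df ε p * randers ε p y + ε * cr p y = Real.sqrt (rad ε p y) := by
  have hd := df_pos hp
  rw [randers_eq hp]; field_simp; ring

theorem randers_sqrt_pos (hp : p ∈ disk ε) (hy : y ≠ 0) :
    0 < df ε p * randers ε p y + ε * cr p y := by
  rw [randers_sqrt hp]; exact Real.sqrt_pos.mpr (rad_pos hp hy)

/-- The square of `randers_sqrt`, divided by `df ε p`. It is the square-root-free form of the
definition of F, and later derivatives of F come from differentiating it implicitly. -/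
theorem randers_quadratic (hp : p ∈ disk ε) :
    df ε p * qf p * randers ε p y ^ 2 + 2 * ε * qf p * cr p y * randers ε p y = kq p y := by
  have hq := qf_pos hp
  have hd := df_pos hp
  have h := Real.sq_sqrt (rad_nonneg (y := y) hp)
  rw [← randers_sqrt hp, rad] at h
  field_simp at h
  have : df ε p * (df ε p * qf p * randers ε p y ^ 2 + 2 * ε * qf p * cr p y * randers ε p y)
      = df ε p * kq p y := by linear_combination h
  exact mul_left_cancel₀ hd.ne' this

theorem randers_pos (hp : p ∈ disk ε) (hy : y ≠ 0) : 0 < randers ε p y := by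
  have hq := qf_pos hp
  have hd := df_pos hp
  have hk := kq_pos hq hy
  rw [randers_eq hp]
  refine div_pos (sub_pos.mpr (Real.lt_sqrt_of_sq_lt ?_)) hd
  have : 0 < df ε p * kq p y / qf p := by positivity
  rw [rad]; linarith

/-- The equation of the unit ball of the Klein metric, shifted by `ε v`. -/
theorem kq_shift (p y : Coord 2) (t : ℝ) (ht : t ≠ 0) :
    t ^ 2 * (qf p ^ 2 - kq p (t⁻¹ • y - ε • rot p))
      = qf p * (df ε p * t ^ 2 + 2 * ε * cr p y * t) - kq p y := by
  simp only [kq, qf, df, cr, PiLp.sub_apply, PiLp.smul_apply, smul_eq_mul, rot_zero, rot_one]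
  field_simp
  ring

theorem kleinNorm_eq_one_iff (hp : 0 < qf p) : kleinNorm p y = 1 ↔ kq p y = qf p ^ 2 := by
  rw [kleinNorm, Real.sqrt_eq_one, klein_self, div_eq_one_iff_eq (by positivity)]

theorem randers_unique (hp : p ∈ disk ε) (hy : y ≠ 0) {t : ℝ} (ht : 0 < t) :
    kleinNorm p (t⁻¹ • y - ε • rot p) = 1 ↔ t = randers ε p y := by
  have hq := qf_pos hp
  have hd := df_pos hp
  have hk := kq_pos hq hy
  have hF := randers_quadratic (y := y) hp
  have hM := randers_sqrt_pos hp hy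
  have hs := kq_shift (ε := ε) p y t ht.ne'
  rw [kleinNorm_eq_one_iff hq]
  constructor
  · intro h
    rw [h, sub_self, mul_zero] at hs
    -- The product equals `kq p y`. Its positivity makes the factor conjugate to t - F positive in
    -- the factorisation below, which excludes the negative root of the quadratic.
    have h1 : 0 < qf p * t * (df ε p * t + 2 * ε * cr p y) := by nlinarith
    have h2 : 0 < df ε p * t + 2 * ε * cr p y := by
      by_contra hneg
      exact absurd h1 (not_lt.mpr (mul_nonpos_of_nonneg_of_nonpos (by positivity)
        (not_lt.mp hneg)))
    have h3 : 0 < df ε p * t := by positivity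
    have h4 : (t - randers ε p y) *
        (df ε p * t + ε * cr p y + (df ε p * randers ε p y + ε * cr p y)) * qf p = 0 := by
      linear_combination (-1) * hs - hF
    rcases mul_eq_zero.mp h4 with h5 | h5
    · rcases mul_eq_zero.mp h5 with h6 | h6
      · linarith
      · nlinarith
    · exact absurd h5 hq.ne'
  · rintro rfl
    have h0 : randers ε p y ^ 2 * (qf p ^ 2 - kq p ((randers ε p y)⁻¹ • y - ε • rot p)) = 0 := by
      rw [hs]; linear_combination hF
    rcases mul_eq_zero.mp h0 with h | h
    · exact absurd h (by positivity)
    · linarith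

theorem alpha_smul (p y : Coord 2) {t : ℝ} (ht : 0 ≤ t) :
    alpha ε p (t • y) = t * alpha ε p y := by
  have h : ε ^ 2 * klein p (rot p) (t • y) ^ 2
      + klein p (t • y) (t • y) * (1 - ε ^ 2 * klein p (rot p) (rot p))
      = t ^ 2 * (ε ^ 2 * klein p (rot p) y ^ 2
        + klein p y y * (1 - ε ^ 2 * klein p (rot p) (rot p))) := by
    simp only [klein, PiLp.smul_apply, smul_eq_mul]; ring
  rw [alpha, alpha, h, Real.sqrt_mul (sq_nonneg t), Real.sqrt_sq ht]; ring

theorem beta_smul (p y : Coord 2) (t : ℝ) : beta ε p (t • y) = t * beta ε p y := by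
  simp only [beta, klein, PiLp.smul_apply, smul_eq_mul]; ring

theorem randers_smul (p y : Coord 2) {t : ℝ} (ht : 0 ≤ t) :
    randers ε p (t • y) = t * randers ε p y := by
  rw [randers, randers, alpha_smul p y ht, beta_smul]; ring

theorem randers_zero (p : Coord 2) : randers ε p 0 = 0 := by
  simpa using randers_smul (ε := ε) p 0 le_rfl

/-! ### Smoothness on the slit tangent bundle -/

section Smooth

theorem contDiff_qf : ContDiff ℝ ∞ qf := by unfold qf; fun_prop

theorem contDiff_df : ContDiff ℝ ∞ (df ε) := by unfold df; fun_prop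

theorem contDiff_kq : ContDiff ℝ ∞ (fun z : Coord 2 × Coord 2 => kq z.1 z.2) := by
  unfold kq qf; fun_prop

theorem contDiff_cr : ContDiff ℝ ∞ (fun z : Coord 2 × Coord 2 => cr z.1 z.2) := by
  unfold cr; fun_prop

theorem smoothOn_randers (ε : ℝ) : SmoothOn (randers ε) (slit (disk ε)) := by
  have hfst : ContDiff ℝ ∞ (Prod.fst : Coord 2 × Coord 2 → Coord 2) := contDiff_fst
  have hq : ContDiffOn ℝ ∞ (fun z : Coord 2 × Coord 2 => qf z.1) (slit (disk ε)) :=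
    (contDiff_qf.comp hfst).contDiffOn
  have hd : ContDiffOn ℝ ∞ (fun z : Coord 2 × Coord 2 => df ε z.1) (slit (disk ε)) :=
    (contDiff_df.comp hfst).contDiffOn
  have hr : ContDiffOn ℝ ∞ (fun z : Coord 2 × Coord 2 => rad ε z.1 z.2) (slit (disk ε)) := by
    unfold rad
    exact ((contDiffOn_const.mul (contDiff_cr.contDiffOn.pow 2))).add
      ((hd.mul contDiff_kq.contDiffOn).div hq fun z hz => (qf_pos hz.1).ne')
  have hs : ContDiffOn ℝ ∞ (fun z : Coord 2 × Coord 2 => Real.sqrt (rad ε z.1 z.2))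
      (slit (disk ε)) := hr.sqrt fun z hz => (rad_pos hz.1 hz.2).ne'
  have hc : ContDiffOn ℝ ∞ (fun z : Coord 2 × Coord 2 => ε * cr z.1 z.2) (slit (disk ε)) :=
    (contDiff_const.mul contDiff_cr).contDiffOn
  exact ((hs.sub hc).div hd fun z hz => (df_pos hz.1).ne').congr fun z hz => randers_eq hz.1

end Smooth

/-! ### Strong convexity -/

section Convex

/-- Gram matrix of `rad ε p`. -/
def radCoeff (ε : ℝ) (p : Coord 2) : Matrix (Fin 2) (Fin 2) ℝ :=
  !![ε ^ 2 * p 1 ^ 2 + df ε p * (1 - p 1 ^ 2) / qf p,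
      -(ε ^ 2 * (p 0 * p 1)) + df ε p * (p 0 * p 1) / qf p;
    -(ε ^ 2 * (p 0 * p 1)) + df ε p * (p 0 * p 1) / qf p,
      ε ^ 2 * p 0 ^ 2 + df ε p * (1 - p 0 ^ 2) / qf p]

theorem rad_eq (ε : ℝ) (p y : Coord 2) : rad ε p y = radCoeff ε p 0 0 * y 0 ^ 2
    + 2 * radCoeff ε p 0 1 * (y 0 * y 1) + radCoeff ε p 1 1 * y 1 ^ 2 := by
  simp only [radCoeff, rad, cr, kq, Matrix.of_apply, Matrix.cons_val', Matrix.cons_val_zero,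
    Matrix.cons_val_one, Matrix.cons_val_fin_one]
  rw [show qf p * (y 0 ^ 2 + y 1 ^ 2) + (p 0 * y 0 + p 1 * y 1) ^ 2
    = (1 - p 1 ^ 2) * y 0 ^ 2 + 2 * (p 0 * p 1) * (y 0 * y 1) + (1 - p 0 ^ 2) * y 1 ^ 2 by
      rw [qf]; ring]
  ring

theorem radCoeff_det (hp : qf p ≠ 0) :
    radCoeff ε p 0 0 * radCoeff ε p 1 1 - radCoeff ε p 0 1 ^ 2 = df ε p := by
  simp only [radCoeff, Matrix.of_apply, Matrix.cons_val', Matrix.cons_val_zero,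
    Matrix.cons_val_one, Matrix.cons_val_fin_one]
  field_simp
  simp only [df, qf]
  ring

theorem randers_hasPd (hp : p ∈ disk ε) (hy : y ≠ 0) (i : Fin 2) :
    HasPd (fun y' => randers ε p y') i (((radCoeff ε p i 0 * y 0 + radCoeff ε p i 1 * y 1)
      / Real.sqrt (rad ε p y) - ε * (if i = 0 then -p 1 else p 0)) / df ε p) y := by
  have hd := (df_pos hp).ne'
  have hR := Real.sqrt_pos.mpr (rad_pos hp hy)
  have h0 := HasPd.coord (i := i) (x := y) (0 : Fin 2)
  have h1 := HasPd.coord (i := i) (x := y) (1 : Fin 2)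
  have hrad : HasPd (fun y' => rad ε p y') i
      (2 * (radCoeff ε p i 0 * y 0 + radCoeff ε p i 1 * y 1)) y := by
    simp only [rad_eq]
    refine (((h0.sq.const_mul _).add ((h0.mul h1).const_mul _)).add
      (h1.sq.const_mul _)).congr_val ?_
    have hs : radCoeff ε p 1 0 = radCoeff ε p 0 1 := rfl
    fin_cases i <;> simp [hs] <;> ring
  have hcr : HasPd (fun y' => cr p y') i (if i = 0 then -p 1 else p 0) y := by
    unfold cr
    refine ((h1.const_mul _).sub (h0.const_mul _)).congr_val ?_
    fin_cases i <;> simp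
  have h := ((hrad.sqrt (rad_pos hp hy)).sub (hcr.const_mul ε)).mul (HasPd.const (df ε p)⁻¹)
  refine (h.congr (.of_forall fun y' => ?_)).congr_val ?_
  · simp only [randers_eq hp, div_eq_mul_inv]
  · field_simp; ring

theorem randers_dY (hp : p ∈ disk ε) (hy : y ≠ 0) (i : Fin 2) :
    dY (randers ε) i p y = ((radCoeff ε p i 0 * y 0 + radCoeff ε p i 1 * y 1)
      / Real.sqrt (rad ε p y) - ε * (if i = 0 then -p 1 else p 0)) / df ε p :=
  (randers_hasPd hp hy i).eq

theorem randers_dY_dY (hp : p ∈ disk ε) (hy : y ≠ 0) (i j : Fin 2) :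
    dY (dY (randers ε) i) j p y = (radCoeff ε p i j * rad ε p y
      - (radCoeff ε p i 0 * y 0 + radCoeff ε p i 1 * y 1)
        * (radCoeff ε p j 0 * y 0 + radCoeff ε p j 1 * y 1))
      / (Real.sqrt (rad ε p y) ^ 3 * df ε p) := by
  have hd := (df_pos hp).ne'
  have hR := Real.sqrt_pos.mpr (rad_pos hp hy)
  have h0 := HasPd.coord (i := j) (x := y) (0 : Fin 2)
  have h1 := HasPd.coord (i := j) (x := y) (1 : Fin 2)
  have hF := randers_hasPd hp hy j
  have hM : HasPd (fun y' => Real.sqrt (rad ε p y')) j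
      ((radCoeff ε p j 0 * y 0 + radCoeff ε p j 1 * y 1) / Real.sqrt (rad ε p y)) y := by
    have hcr : HasPd (fun y' => cr p y') j (if j = 0 then -p 1 else p 0) y := by
      unfold cr
      refine ((h1.const_mul _).sub (h0.const_mul _)).congr_val ?_
      fin_cases j <;> simp
    -- The square root is affine in F at fixed y, by `randers_sqrt`, so its derivative is read off
    -- from that of F.
    refine (((hF.const_mul (df ε p)).add (hcr.const_mul ε)).congr
      (.of_forall fun y' => randers_sqrt hp)).congr_val ?_
    field_simp; ring
  have h2 := ((((h0.const_mul (radCoeff ε p i 0)).add (h1.const_mul (radCoeff ε p i 1))).div hM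
    hR.ne').sub (HasPd.const (ε * (if i = 0 then -p 1 else p 0)))).mul (HasPd.const (df ε p)⁻¹)
  have h3 := h2.congr (g := fun y' => dY (randers ε) i p y') <| by
    filter_upwards [isOpen_ne.mem_nhds hy] with y' hy'
    rw [randers_dY hp hy']; ring
  rw [show dY (dY (randers ε) i) j p y = _ from h3.eq]
  have hsq := Real.sq_sqrt (rad_nonneg (y := y) hp)
  have hc : radCoeff ε p i 0 * (if (0 : Fin 2) = j then 1 else 0)
      + radCoeff ε p i 1 * (if (1 : Fin 2) = j then 1 else 0) = radCoeff ε p i j := by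
    fin_cases j <;> simp
  rw [hc]
  field_simp
  rw [hsq]
  ring

theorem isFinslerOn_randers (ε : ℝ) : IsFinslerOn (disk ε) (randers ε) where
  smooth := smoothOn_randers ε
  zero p _ := randers_zero p
  pos p hp y hy := randers_pos hp hy
  homog p _ y t ht := randers_smul p y ht.le
  convex p hp y hy u hu := by
    have hd := df_pos hp
    have hR := Real.sqrt_pos.mpr (rad_pos hp hy)
    have hF := randers_pos hp hy
    have heul : y 0 * dY (randers ε) 0 p y + y 1 * dY (randers ε) 1 p y = randers ε p y := by
      have hsq := Real.sq_sqrt (rad_nonneg (y := y) hp)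
      rw [randers_dY hp hy, randers_dY hp hy, randers_eq hp]
      have hs : radCoeff ε p 1 0 = radCoeff ε p 0 1 := rfl
      generalize Real.sqrt (rad ε p y) = R at *
      rw [rad_eq] at hsq
      simp only [hs, cr, if_true, one_ne_zero, if_false]
      field_simp
      linear_combination -hsq
    -- With A the Gram matrix of `rad`, Lagrange's identity (uᵀAu)(yᵀAy) - (uᵀAy)² = det A · (y ×
    -- u)² collapses the Hessian of F to one square; det A = `df ε p` cancels the denominator.
    have hsum : ∑ i, ∑ j, fundTensor (randers ε) p y i j * u i * u j
        = (u 0 * dY (randers ε) 0 p y + u 1 * dY (randers ε) 1 p y) ^ 2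
          + randers ε p y * (cr y u ^ 2 / Real.sqrt (rad ε p y) ^ 3) := by
      simp only [(smoothOn_randers ε).fundTensor_eq (isOpen_disk ε) hp hy, randers_dY_dY hp hy,
        Fin.sum_univ_two]
      have hdet := radCoeff_det (ε := ε) (qf_pos hp).ne'
      have hs : radCoeff ε p 1 0 = radCoeff ε p 0 1 := rfl
      generalize Real.sqrt (rad ε p y) = R at *
      have h1 : cr y u ^ 2 / R ^ 3 = cr y u ^ 2 *
          (radCoeff ε p 0 0 * radCoeff ε p 1 1 - radCoeff ε p 0 1 ^ 2) / (R ^ 3 * df ε p) := by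
        rw [hdet]; field_simp
      rw [h1, hs, rad_eq, cr]
      ring
    rw [hsum]
    -- If u is parallel to y the Hessian term vanishes, but then dF(u) cannot: together with Euler's
    -- relation, dF(u) = 0 would give F u = 0.
    by_cases hc : cr y u = 0
    · have hy2 := sq_add_sq_pos hy
      have hu2 := sq_add_sq_pos hu
      have hne : u 0 * dY (randers ε) 0 p y + u 1 * dY (randers ε) 1 p y ≠ 0 := by
        intro h0
        simp only [cr] at hc
        have e0 : u 0 * randers ε p y = 0 := by
          rw [← heul]
          linear_combination y 0 * h0 - dY (randers ε) 1 p y * hc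
        have e1 : u 1 * randers ε p y = 0 := by
          rw [← heul]
          linear_combination y 1 * h0 + dY (randers ε) 0 p y * hc
        have e0' : u 0 = 0 := (mul_eq_zero.mp e0).resolve_right hF.ne'
        have e1' : u 1 = 0 := (mul_eq_zero.mp e1).resolve_right hF.ne'
        simp [e0', e1'] at hu2
      positivity
    · positivity

end Convex

/-! ### The Randers structure -/

section Randers

theorem alphaCoeff_eq (hp : p ∈ disk ε) (i j : Fin 2) :
    alphaCoeff ε p i j = radCoeff ε p i j / df ε p ^ 2 := by
  have hq := qf_pos hp
  have hd := df_pos hp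
  simp only [alphaCoeff, Matrix.of_apply]
  rw [one_sub_klein_rot hq.ne', klein_rot hq.ne', klein_rot hq.ne']
  have hk : klein p (e i) (e j) = ((if i = j then 1 else 0) -
      (if i = 0 then -p 1 else p 0) * (if j = 0 then -p 1 else p 0)) / qf p ^ 2 := by
    simp only [klein, e_apply, qf]
    fin_cases i <;> fin_cases j <;> simp
  have hcr (i : Fin 2) : cr p (e i) = if i = 0 then -p 1 else p 0 := by
    fin_cases i <;> simp [cr]
  rw [hk, hcr, hcr]
  fin_cases i <;> fin_cases j <;> simp [radCoeff] <;> field_simp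

theorem sum_alphaCoeff (hp : p ∈ disk ε) :
    ∑ i, ∑ j, alphaCoeff ε p i j * y i * y j = rad ε p y / df ε p ^ 2 := by
  have hs : radCoeff ε p 1 0 = radCoeff ε p 0 1 := rfl
  simp only [alphaCoeff_eq hp, Fin.sum_univ_two, rad_eq, hs]
  ring

theorem contDiffOn_alphaCoeff (ε : ℝ) (i j : Fin 2) :
    ContDiffOn ℝ ∞ (fun p => alphaCoeff ε p i j) (disk ε) := by
  have hd : ContDiffOn ℝ ∞ (df ε) (disk ε) := contDiff_df.contDiffOn
  have hq : ContDiffOn ℝ ∞ qf (disk ε) := contDiff_qf.contDiffOn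
  refine ContDiffOn.congr (f := fun p => radCoeff ε p i j / df ε p ^ 2) ?_
    fun p hp => alphaCoeff_eq hp i j
  refine ContDiffOn.div ?_ (hd.pow 2) fun p hp => (pow_pos (df_pos hp) 2).ne'
  have h1 (f g : Coord 2 → ℝ) (hf : ContDiff ℝ ∞ f) (hg : ContDiff ℝ ∞ g) :
      ContDiffOn ℝ ∞ (fun p => f p + df ε p * g p / qf p) (disk ε) :=
    hf.contDiffOn.add ((hd.mul hg.contDiffOn).div hq fun p hp => (qf_pos hp).ne')
  fin_cases i <;> fin_cases j <;>
    simpa [radCoeff] using h1 _ _ (by fun_prop) (by fun_prop)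

theorem contDiffOn_betaCoeff (ε : ℝ) (i : Fin 2) :
    ContDiffOn ℝ ∞ (fun p => betaCoeff ε p i) (disk ε) := by
  refine ContDiffOn.congr (f := fun p => -(ε * cr p (e i) / df ε p)) ?_ fun p hp => beta_eq hp
  refine (ContDiffOn.div ?_ contDiff_df.contDiffOn fun p hp => (df_pos hp).ne').neg
  unfold cr
  fun_prop

/-- Lagrange's identity |p|² |y|² = (p × y)² + ⟨p, y⟩² diagonalises `rad` in the angular and radial
directions. Dropping the radial square bounds β by α. -/
theorem rad_mul_norm_sq (hq : qf p ≠ 0) : (p 0 ^ 2 + p 1 ^ 2) * rad ε p y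
    = qf p * cr p y ^ 2 + df ε p * (p 0 * y 0 + p 1 * y 1) ^ 2 / qf p := by
  rw [rad]
  field_simp
  simp only [qf, df, kq, cr]
  ring

theorem isRandersOn_randers (ε : ℝ) : IsRandersOn (disk ε) (alphaCoeff ε) (betaCoeff ε)
    (alpha ε) (beta ε) (randers ε) where
  riemannian := {
    smooth := contDiffOn_alphaCoeff ε
    posDef := fun p hp => by
      refine Matrix.PosDef.of_dotProduct_mulVec_pos ?_ fun x hx => ?_
      · ext i j
        simp only [Matrix.conjTranspose_apply, star_trivial, alphaCoeff_eq hp]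
        fin_cases i <;> fin_cases j <;> rfl
      · have h := sum_alphaCoeff (ε := ε) (y := WithLp.toLp 2 x) hp
        have h2 : 0 < rad ε p (WithLp.toLp 2 x) / df ε p ^ 2 :=
          div_pos (rad_pos hp (by simpa using hx)) (pow_pos (df_pos hp) 2)
        rw [← h] at h2
        simp only [Fin.sum_univ_two, Matrix.mulVec, dotProduct, star_trivial, Pi.star_apply] at h2 ⊢
        linarith
    eq_sqrt := fun p hp y => by
      rw [sum_alphaCoeff hp, alpha_eq hp, Real.sqrt_div (rad_nonneg hp),
        Real.sqrt_sq (df_pos hp).le] }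
  smooth := contDiffOn_betaCoeff ε
  oneForm p hp y := by
    simp only [betaCoeff, beta_eq hp, Fin.sum_univ_two, cr, e_apply]
    simp
    ring
  norm_lt_one p hp := by
    have hq := qf_pos hp
    have hd := df_pos hp
    -- The witness is the Klein norm of εv; it is below 1 because qf - ε²|p|² = df > 0.
    refine ⟨Real.sqrt (ε ^ 2 * (p 0 ^ 2 + p 1 ^ 2) / qf p), ?_, fun y => ?_⟩
    · rw [Real.sqrt_lt' one_pos, one_pow, div_lt_one hq]
      linarith [qf_eq ε p]
    · rw [beta_eq hp, alpha_eq hp, ← mul_div_assoc, ← neg_div, ← Real.sqrt_mul (by positivity)]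
      refine div_le_div_of_nonneg_right (Real.le_sqrt_of_sq_le ?_) hd.le
      have h := rad_mul_norm_sq (ε := ε) (y := y) hq.ne'
      have : 0 ≤ df ε p * (p 0 * y 0 + p 1 * y 1) ^ 2 / qf p := by positivity
      rw [div_mul_eq_mul_div, le_div_iff₀ hq, mul_assoc (ε ^ 2), h]
      nlinarith [sq_nonneg ε]
  eq_sum _ _ _ := rfl

end Randers

end

/-! ### The spray of F -/

section

/-- The projective factor `⟨x, y⟩ / (1 - |x|²)` of the Klein metric. -/
def kp (x y : Coord 2) : ℝ := (x 0 * y 0 + x 1 * y 1) / qf x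

/-- The spray coefficients of `randers ε`. -/
def randersSpray (ε : ℝ) (i : Fin 2) (x y : Coord 2) : ℝ :=
  kp x y * y i - ε * randers ε x y * (rot y i + kp x y * rot x i)
    - ε ^ 2 / 2 * randers ε x y ^ 2 * x i

variable {ε : ℝ} {x y : Coord 2}

theorem HasPd.coord_e {n : ℕ} {x : Coord n} (i j : Fin n) :
    HasPd (fun x : Coord n => x j) i (e i j) x :=
  (HasPd.coord j).congr_val (e_apply i j).symm

theorem HasPd.rot (i j : Fin 2) : HasPd (fun x : Coord 2 => rot x j) i (rot (e i) j) x := by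
  fin_cases j
  · simpa using (HasPd.coord_e (x := x) i 1).neg
  · simpa using HasPd.coord_e (x := x) i 0

theorem HasPd.qf (i : Fin 2) : HasPd qf i (-2 * x i) x := by
  unfold Finsler.qf
  refine ((HasPd.const 1).sub ((HasPd.coord_e i 0).sq.add (HasPd.coord_e i 1).sq)).congr_val ?_
  fin_cases i <;> simp

theorem HasPd.df (i : Fin 2) : HasPd (df ε) i (-2 * (1 + ε ^ 2) * x i) x := by
  unfold Finsler.df
  refine ((HasPd.const 1).sub
    (((HasPd.coord_e i 0).sq.add (HasPd.coord_e i 1).sq).const_mul _)).congr_val ?_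
  fin_cases i <;> simp <;> ring

theorem HasPd.pairing_left (i : Fin 2) :
    HasPd (fun x => x 0 * y 0 + x 1 * y 1) i (y i) x := by
  refine (((HasPd.coord_e i 0).mul (HasPd.const (y 0))).add
    ((HasPd.coord_e i 1).mul (HasPd.const (y 1)))).congr_val ?_
  fin_cases i <;> simp

theorem HasPd.pairing_right (i : Fin 2) :
    HasPd (fun y => x 0 * y 0 + x 1 * y 1) i (x i) y := by
  refine (((HasPd.coord_e i 0).const_mul (x 0)).add
    ((HasPd.coord_e i 1).const_mul (x 1))).congr_val ?_
  fin_cases i <;> simp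

theorem HasPd.cr_left (i : Fin 2) : HasPd (fun x => cr x y) i (-Finsler.rot y i) x := by
  unfold cr
  refine (((HasPd.coord_e i 0).mul (HasPd.const (y 1))).sub
    ((HasPd.coord_e i 1).mul (HasPd.const (y 0)))).congr_val ?_
  fin_cases i <;> simp

theorem HasPd.cr_right (i : Fin 2) : HasPd (fun y => cr x y) i (Finsler.rot x i) y := by
  unfold cr
  refine (((HasPd.coord_e i 1).const_mul (x 0)).sub
    ((HasPd.coord_e i 0).const_mul (x 1))).congr_val ?_
  fin_cases i <;> simp

theorem HasPd.kq_left (i : Fin 2) : HasPd (fun x => kq x y) i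
    (-2 * x i * (y 0 ^ 2 + y 1 ^ 2) + 2 * (x 0 * y 0 + x 1 * y 1) * y i) x := by
  unfold kq
  exact (((HasPd.qf i).mul (HasPd.const _)).add (HasPd.pairing_left i).sq).congr_val (by ring)

theorem HasPd.kq_right (i : Fin 2) : HasPd (fun y => kq x y) i
    (2 * Finsler.qf x * y i + 2 * (x 0 * y 0 + x 1 * y 1) * x i) y := by
  unfold kq
  refine ((((HasPd.coord_e i 0).sq.add (HasPd.coord_e i 1).sq).const_mul _).add
    (HasPd.pairing_right i).sq).congr_val ?_
  fin_cases i <;> simp <;> ring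

theorem HasPd.kp_left (hq : Finsler.qf x ≠ 0) (i : Fin 2) : HasPd (fun x => kp x y) i
    (y i / Finsler.qf x + 2 * x i * kp x y / Finsler.qf x) x := by
  unfold kp
  exact ((HasPd.pairing_left i).div (HasPd.qf i) hq).congr_val (by field_simp; ring)

theorem HasPd.kp_right (i : Fin 2) : HasPd (fun y => kp x y) i (x i / Finsler.qf x) y := by
  unfold kp
  simp only [div_eq_mul_inv]
  exact ((HasPd.pairing_right i).mul (HasPd.const _)).congr_val (by ring)

theorem HasPd.coord_div_qf (hq : Finsler.qf x ≠ 0) (i k : Fin 2) :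
    HasPd (fun x => x k / Finsler.qf x) i
      (e i k / Finsler.qf x + 2 * x i * x k / Finsler.qf x ^ 2) x :=
  ((HasPd.coord_e i k).div (HasPd.qf i) hq).congr_val (by field_simp; ring)

section First

theorem mem_slit (hx : x ∈ disk ε) (hy : y ≠ 0) : (x, y) ∈ slit (disk ε) := ⟨hx, hy⟩

theorem isOpen_slit_disk (ε : ℝ) : IsOpen (slit (disk ε)) := isOpen_slit (isOpen_disk ε)

theorem randers_hasPd_left (hx : x ∈ disk ε) (hy : y ≠ 0) (k : Fin 2) :
    HasPd (fun x' => randers ε x' y) k (dX (randers ε) k x y) x :=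
  (smoothOn_randers ε).hasPd_left (isOpen_slit_disk ε) (mem_slit hx hy) k

theorem randers_hasPd_right (hx : x ∈ disk ε) (hy : y ≠ 0) (k : Fin 2) :
    HasPd (fun y' => randers ε x y') k (dY (randers ε) k x y) y :=
  (smoothOn_randers ε).hasPd_right (isOpen_slit_disk ε) (mem_slit hx hy) k

/-- Implicit differentiation of `randers_quadratic` in y. The factor df · F + ε (x × y) on the left
is the square root of `rad`, hence nonzero and cancellable. -/
theorem qf_mul_dY_randers (hx : x ∈ disk ε) (hy : y ≠ 0) (k : Fin 2) :
    qf x * (df ε x * randers ε x y + ε * cr x y) * dY (randers ε) k x y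
      = qf x * y k + (x 0 * y 0 + x 1 * y 1) * x k - ε * qf x * rot x k * randers ε x y := by
  have hF := randers_hasPd_right hx hy k
  have h1 := (hF.sq.const_mul (df ε x * qf x)).add
    (((HasPd.cr_right (x := x) k).mul hF).const_mul (2 * ε * qf x))
  have h2 := h1.unique <| (HasPd.kq_right (x := x) k).congr <| by
    filter_upwards with y'
    rw [← randers_quadratic hx]; ring
  linear_combination h2 / 2

theorem qf_mul_dX_randers (hx : x ∈ disk ε) (hy : y ≠ 0) (k : Fin 2) :
    qf x * (df ε x * randers ε x y + ε * cr x y) * dX (randers ε) k x y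
      = -x k * (y 0 ^ 2 + y 1 ^ 2) + (x 0 * y 0 + x 1 * y 1) * y k
        + ((1 + ε ^ 2) * qf x + df ε x) * x k * randers ε x y ^ 2
        + ε * (2 * x k * cr x y + qf x * rot y k) * randers ε x y := by
  have hF := randers_hasPd_left hx hy k
  have h1 := (((HasPd.df (ε := ε) k).mul (HasPd.qf k)).mul hF.sq).add
    ((((HasPd.qf k).mul (HasPd.cr_left (y := y) k)).mul hF).const_mul (2 * ε))
  have h2 := h1.unique <| (HasPd.kq_left (y := y) k).congr <| by
    filter_upwards [(isOpen_disk ε).mem_nhds hx] with x' hx'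
    rw [← randers_quadratic hx']; ring
  linear_combination h2 / 2

/-- The vector V = rot y + P rot x + εF x is tangent to the indicatrix. On F = 1, put w = y - ε rot
x; then V = rot w + P rot x is Klein-orthogonal to w, while dF is proportional to h(w, ·). In
G^i_{y^k} the derivative F_{y^k} occurs only in the product -ε F_{y^k} V^i. -/
theorem randers_dY_rotational (hx : x ∈ disk ε) (hy : y ≠ 0) :
    dY (randers ε) 0 x y * (-y 1 - kp x y * x 1 + ε * randers ε x y * x 0)
      + dY (randers ε) 1 x y * (y 0 + kp x y * x 0 + ε * randers ε x y * x 1) = 0 := by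
  have hq := (qf_pos hx).ne'
  have hM := (randers_sqrt_pos hx hy).ne'
  have h0 := qf_mul_dY_randers hx hy 0
  have h1 := qf_mul_dY_randers hx hy 1
  have key : qf x * (df ε x * randers ε x y + ε * cr x y) *
      (dY (randers ε) 0 x y * (-y 1 - kp x y * x 1 + ε * randers ε x y * x 0)
      + dY (randers ε) 1 x y * (y 0 + kp x y * x 0 + ε * randers ε x y * x 1)) = 0 := by
    rw [rot_zero] at h0
    rw [rot_one] at h1
    unfold kp
    linear_combination (norm := (field_simp; ring))
      (-y 1 - (x 0 * y 0 + x 1 * y 1) / qf x * x 1 + ε * randers ε x y * x 0) * h0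
      + (y 0 + (x 0 * y 0 + x 1 * y 1) / qf x * x 0 + ε * randers ε x y * x 1) * h1
  exact (mul_eq_zero.mp key).resolve_left (mul_ne_zero hq hM)

theorem smoothOn_randersSpray (ε : ℝ) (i : Fin 2) :
    SmoothOn (randersSpray ε i) (slit (disk ε)) := by
  have hF : ContDiffOn ℝ ∞ (fun z : Coord 2 × Coord 2 => randers ε z.1 z.2) (slit (disk ε)) :=
    smoothOn_randers ε
  have hq : ContDiffOn ℝ ∞ (fun z : Coord 2 × Coord 2 => qf z.1) (slit (disk ε)) :=
    (contDiff_qf.comp contDiff_fst).contDiffOn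
  have hP : ContDiffOn ℝ ∞ (fun z : Coord 2 × Coord 2 => kp z.1 z.2) (slit (disk ε)) :=
    ContDiffOn.div (by fun_prop) hq fun z hz => (qf_pos hz.1).ne'
  have hr1 : ContDiffOn ℝ ∞ (fun z : Coord 2 × Coord 2 => rot z.1 i) (slit (disk ε)) := by
    fin_cases i <;> simp <;> fun_prop
  have hr2 : ContDiffOn ℝ ∞ (fun z : Coord 2 × Coord 2 => rot z.2 i) (slit (disk ε)) := by
    fin_cases i <;> simp <;> fun_prop
  have h1 : ContDiffOn ℝ ∞ (fun z : Coord 2 × Coord 2 => z.1 i) (slit (disk ε)) := by fun_prop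
  have h2 : ContDiffOn ℝ ∞ (fun z : Coord 2 × Coord 2 => z.2 i) (slit (disk ε)) := by fun_prop
  exact ((hP.mul h2).sub ((contDiffOn_const.mul hF).mul (hr2.add (hP.mul hr1)))).sub
    ((contDiffOn_const.mul (hF.pow 2)).mul h1)

theorem randersSpray_hasPd_right (hx : x ∈ disk ε) (hy : y ≠ 0) (i k : Fin 2) :
    HasPd (fun y' => randersSpray ε i x y') k
      (x k / qf x * y i + kp x y * e k i
        - ε * dY (randers ε) k x y * (rot y i + kp x y * rot x i)
        - ε * randers ε x y * (rot (e k) i + x k / qf x * rot x i)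
        - ε ^ 2 * (randers ε x y * dY (randers ε) k x y) * x i) y := by
  have hF := randers_hasPd_right hx hy k
  have hP := HasPd.kp_right (x := x) (y := y) k
  exact (((hP.mul (HasPd.coord_e k i)).sub ((hF.const_mul ε).mul ((HasPd.rot k i).add
    (hP.mul (HasPd.const (rot x i)))))).sub
      ((hF.sq.const_mul (ε ^ 2 / 2)).mul (HasPd.const (x i)))).congr_val (by ring)

theorem randersSpray_hasPd_left (hx : x ∈ disk ε) (hy : y ≠ 0) (i k : Fin 2) :
    HasPd (fun x' => randersSpray ε i x' y) k
      ((y k / qf x + 2 * x k * kp x y / qf x) * y i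
        - ε * dX (randers ε) k x y * (rot y i + kp x y * rot x i)
        - ε * randers ε x y * ((y k / qf x + 2 * x k * kp x y / qf x) * rot x i
          + kp x y * rot (e k) i)
        - ε ^ 2 * (randers ε x y * dX (randers ε) k x y) * x i
        - ε ^ 2 / 2 * randers ε x y ^ 2 * e k i) x := by
  have hF := randers_hasPd_left hx hy k
  have hP := HasPd.kp_left (x := x) (y := y) (qf_pos hx).ne' k
  exact (((hP.mul (HasPd.const (y i))).sub ((hF.const_mul ε).mul ((HasPd.const (rot y i)).add
    (hP.mul (HasPd.rot k i))))).sub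
      ((hF.sq.const_mul (ε ^ 2 / 2)).mul (HasPd.coord_e k i))).congr_val (by ring)

theorem dY_randersSpray (hx : x ∈ disk ε) (hy : y ≠ 0) (i k : Fin 2) :
    dY (randersSpray ε i) k x y = x k / qf x * y i + kp x y * e k i
        - ε * dY (randers ε) k x y * (rot y i + kp x y * rot x i)
        - ε * randers ε x y * (rot (e k) i + x k / qf x * rot x i)
        - ε ^ 2 * (randers ε x y * dY (randers ε) k x y) * x i :=
  (randersSpray_hasPd_right hx hy i k).eq

/-- Contracting G^j_{y^k} with F_{y^j} kills the terms in V. What remains is compared with the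
implicit formula for F_{x^k}, after multiplication by the nonzero factor qf · (df · F + ε (x × y)).
-/
theorem isSprayOn_randersSpray (ε : ℝ) : IsSprayOn (disk ε) (randers ε) (randersSpray ε) where
  smooth := smoothOn_randersSpray ε
  euler x hx y hy i := by
    have hE := (isFinslerOn_randers ε).euler (isOpen_disk ε) hx hy
    have hq := (qf_pos hx).ne'
    simp only [Fin.sum_univ_two] at hE ⊢
    rw [dY_randersSpray hx hy, dY_randersSpray hx hy, randersSpray]
    have h1 : x 0 / qf x * y 0 + x 1 / qf x * y 1 = kp x y := by rw [kp]; ring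
    have h2 : y 0 * e 0 i + y 1 * e 1 i = y i := by fin_cases i <;> simp
    have h3 : y 0 * rot (e 0) i + y 1 * rot (e 1) i = rot y i := by fin_cases i <;> simp
    linear_combination
      (-ε * (rot y i + kp x y * rot x i + ε * randers ε x y * x i)) * hE
      + (y i - ε * randers ε x y * rot x i) * h1 + kp x y * h2 - ε * randers ε x y * h3
  horizontal x hx y hy k := by
    have hq := (qf_pos hx).ne'
    have hM := (randers_sqrt_pos hx hy).ne'
    have h0 := qf_mul_dY_randers hx hy 0
    have h1 := qf_mul_dY_randers hx hy 1
    have hk := qf_mul_dX_randers hx hy k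
    have hV := randers_dY_rotational hx hy
    have hQ := randers_quadratic (y := y) hx
    simp only [Fin.sum_univ_two]
    rw [dY_randersSpray hx hy, dY_randersSpray hx hy]
    refine mul_left_cancel₀ (mul_ne_zero hq hM) ?_
    rw [hk]
    -- Once `qf x` is generalised, this is the only remaining link between it and `df ε x`.
    have hd : df ε x = qf x - ε ^ 2 * (x 0 ^ 2 + x 1 ^ 2) := by rw [qf_eq ε]; ring
    unfold kp at *
    unfold kq at hQ
    simp only [cr, rot_zero, rot_one] at *
    set F := randers ε x y
    set F0 := dY (randers ε) 0 x y
    set F1 := dY (randers ε) 1 x y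
    generalize qf x = q at *
    obtain rfl | rfl : k = 0 ∨ k = 1 := by fin_cases k <;> simp
    · simp
      linear_combination (norm := (field_simp; ring))
        -(x 0 / q * y 0 + (x 0 * y 0 + x 1 * y 1) / q + ε * F * (x 0 / q * x 1)) * h0
        - (x 0 / q * y 1 - ε * F * (1 + x 0 / q * x 0)) * h1 + 2 * x 0 / q * hQ
        + ε * q * (df ε x * F + ε * (x 0 * y 1 - x 1 * y 0)) * F0 * hV
        - x 0 * F ^ 2 * hd
    · simp
      linear_combination (norm := (field_simp; ring))
        -(x 1 / q * y 0 + ε * F * (1 + x 1 / q * x 1)) * h0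
        - (x 1 / q * y 1 + (x 0 * y 0 + x 1 * y 1) / q - ε * F * (x 1 / q * x 0)) * h1
        + 2 * x 1 / q * hQ
        + ε * q * (df ε x * F + ε * (x 0 * y 1 - x 1 * y 0)) * F1 * hV
        - x 1 * F ^ 2 * hd

end First

end

/-! ### Flag curvature -/

section

variable {ε : ℝ} {x y : Coord 2}

theorem dX_dY_randersSpray (hx : x ∈ disk ε) (hy : y ≠ 0) (i k j : Fin 2) :
    dX (dY (randersSpray ε i) k) j x y =
      (e j k / qf x + 2 * x j * x k / qf x ^ 2) * y i
        + (y j / qf x + 2 * x j * kp x y / qf x) * e k i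
        - ε * dX (dY (randers ε) k) j x y * (rot y i + kp x y * rot x i)
        - ε * dY (randers ε) k x y *
          ((y j / qf x + 2 * x j * kp x y / qf x) * rot x i + kp x y * rot (e j) i)
        - ε * dX (randers ε) j x y * (rot (e k) i + x k / qf x * rot x i)
        - ε * randers ε x y * ((e j k / qf x + 2 * x j * x k / qf x ^ 2) * rot x i
          + x k / qf x * rot (e j) i)
        - ε ^ 2 * (dX (randers ε) j x y * dY (randers ε) k x y
          + randers ε x y * dX (dY (randers ε) k) j x y) * x i
        - ε ^ 2 * (randers ε x y * dY (randers ε) k x y) * e j i := by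
  have hq := (qf_pos hx).ne'
  have hF := randers_hasPd_left hx hy j
  have hFk := ((smoothOn_randers ε).dY_smooth (isOpen_slit_disk ε) k).hasPd_left
    (isOpen_slit_disk ε) (mem_slit hx hy) j
  have hP := HasPd.kp_left (y := y) hq j
  have hxk := HasPd.coord_div_qf hq j k
  have hxi := HasPd.coord_e (x := x) j i
  have hri := HasPd.rot (x := x) j i
  have h := (((((hxk.mul (HasPd.const (y i))).add (hP.mul (HasPd.const (e k i)))).sub
    ((hFk.const_mul ε).mul ((HasPd.const (rot y i)).add (hP.mul hri)))).sub
    ((hF.const_mul ε).mul ((HasPd.const (rot (e k) i)).add (hxk.mul hri)))).sub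
    (((hF.mul hFk).const_mul (ε ^ 2)).mul hxi))
  refine (h.congr (g := fun x' => dY (randersSpray ε i) k x' y) ?_).eq.trans (by ring)
  filter_upwards [(isOpen_disk ε).mem_nhds hx] with x' hx' using (dY_randersSpray hx' hy i k).symm

theorem dY_dY_randersSpray (hx : x ∈ disk ε) (hy : y ≠ 0) (i k j : Fin 2) :
    dY (dY (randersSpray ε i) k) j x y =
      x k / qf x * e j i + x j / qf x * e k i
        - ε * dY (dY (randers ε) k) j x y * (rot y i + kp x y * rot x i)
        - ε * dY (randers ε) k x y * (rot (e j) i + x j / qf x * rot x i)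
        - ε * dY (randers ε) j x y * (rot (e k) i + x k / qf x * rot x i)
        - ε ^ 2 * (dY (randers ε) j x y * dY (randers ε) k x y
          + randers ε x y * dY (dY (randers ε) k) j x y) * x i := by
  have hF := randers_hasPd_right hx hy j
  have hFk := ((smoothOn_randers ε).dY_smooth (isOpen_slit_disk ε) k).hasPd_right
    (isOpen_slit_disk ε) (mem_slit hx hy) j
  have hP := HasPd.kp_right (x := x) (y := y) j
  have hyi := HasPd.coord_e (x := y) j i
  have hri := HasPd.rot (x := y) j i
  have h := (((((hyi.const_mul (x k / qf x)).add (hP.mul (HasPd.const (e k i)))).sub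
    ((hFk.const_mul ε).mul (hri.add (hP.mul (HasPd.const (rot x i)))))).sub
    ((hF.const_mul ε).mul (HasPd.const (rot (e k) i + x k / qf x * rot x i)))).sub
    (((hF.mul hFk).const_mul (ε ^ 2)).mul (HasPd.const (x i))))
  refine (h.congr (g := fun y' => dY (randersSpray ε i) k x y') ?_).eq.trans (by ring)
  filter_upwards [isOpen_ne.mem_nhds hy] with y' hy' using (dY_randersSpray hx hy' i k).symm

/-- Second derivatives of F enter the curvature only as ε V^i (y^j F_{x^j y^k} - 2 G^j F_{y^j y^k}),
with V as in `randers_dY_rotational`. By `hT` the bracket is F_{x^k}, which `hH` expresses through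
dF; `hC` removes y^j F_{x^j}. The remaining identity involves only F and dF and follows from the
quadratic equation `hQ`, its y-derivative `hk` and the relation `hd`. -/
theorem hasConstCurvatureOn_randers (ε : ℝ) :
    HasConstCurvatureOn (disk ε) (randers ε) (-1) := by
  intro x hx y hy i k
  have hS := isSprayOn_randersSpray ε
  have hFin := isFinslerOn_randers ε
  have hU := isOpen_disk ε
  have hq := (qf_pos hx).ne'
  have hk := qf_mul_dY_randers hx hy k
  have hQ := randers_quadratic (y := y) hx
  have hT := hS.dX_dY_contract hFin hU hx hy k
  have hC := hS.dX_contract hx hy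
  have hH := hS.horizontal x hx y hy k
  rw [hS.riemCurv_eq hFin hU hx hy]
  have hX : dX (randersSpray ε i) k x y = _ := (randersSpray_hasPd_left hx hy i k).eq
  have hFk : pd (fun w => randers ε x w) k y = dY (randers ε) k x y := rfl
  have hd : df ε x = qf x - ε ^ 2 * (x 0 ^ 2 + x 1 ^ 2) := by rw [qf_eq ε]; ring
  rw [hX, hFk]
  simp only [dX_dY_randersSpray hx hy, dY_dY_randersSpray hx hy, dY_randersSpray hx hy,
    Fin.sum_univ_two] at hH ⊢
  simp only [Fin.sum_univ_two] at hT hC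
  simp only [randersSpray, kp, kq, cr] at *
  clear hX hFk
  obtain rfl | rfl : k = 0 ∨ k = 1 := by fin_cases k <;> simp
  all_goals
    obtain rfl | rfl : i = 0 ∨ i = 1 := by fin_cases i <;> simp
  all_goals
    generalize dX (randers ε) 0 x y = X0 at *
    generalize dX (randers ε) 1 x y = X1 at *
    generalize dY (randers ε) 0 x y = F0 at *
    generalize dY (randers ε) 1 x y = F1 at *
    generalize qf x = q at *
    generalize df ε x = D at *
    generalize randers ε x y = F at *
    simp only [e_apply, rot_zero, rot_one, if_true, one_ne_zero, zero_ne_one, if_false,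
      Fin.isValue] at hT hC hH hk hQ ⊢
  ·   linear_combination (norm := (field_simp; ring))
        ε * (-y 1 - (x 0 * y 0 + x 1 * y 1) / q * x 1 + ε * F * x 0) * hT - ε * (-y 1 - (x 0 * y 0 + x 1 * y 1) / q * x 1 + ε * F * x 0) * hH
        + (ε * (0 + x 0 / q * (-x 1)) + ε ^ 2 * F0 * x 0) * hC
        + (1 - ε * F0 * (-x 1)) / q ^ 2 * hQ
        + (F * (y 0 + ε * F * x 1) * F0 / q - (1 - ε * F0 * (-x 1)) * F ^ 2 / q) * hd
        - (y 0 + ε * F * x 1) / q ^ 2 * hk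
  ·   linear_combination (norm := (field_simp; ring))
        ε * (y 0 + (x 0 * y 0 + x 1 * y 1) / q * x 0 + ε * F * x 1) * hT - ε * (y 0 + (x 0 * y 0 + x 1 * y 1) / q * x 0 + ε * F * x 1) * hH
        + (ε * (1 + x 0 / q * x 0) + ε ^ 2 * F0 * x 1) * hC
        + (0 - ε * F0 * x 0) / q ^ 2 * hQ
        + (F * (y 1 - ε * F * x 0) * F0 / q - (0 - ε * F0 * x 0) * F ^ 2 / q) * hd
        - (y 1 - ε * F * x 0) / q ^ 2 * hk
  ·   linear_combination (norm := (field_simp; ring))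
        ε * (-y 1 - (x 0 * y 0 + x 1 * y 1) / q * x 1 + ε * F * x 0) * hT - ε * (-y 1 - (x 0 * y 0 + x 1 * y 1) / q * x 1 + ε * F * x 0) * hH
        + (ε * ((-1) + x 1 / q * (-x 1)) + ε ^ 2 * F1 * x 0) * hC
        + (0 - ε * F1 * (-x 1)) / q ^ 2 * hQ
        + (F * (y 0 + ε * F * x 1) * F1 / q - (0 - ε * F1 * (-x 1)) * F ^ 2 / q) * hd
        - (y 0 + ε * F * x 1) / q ^ 2 * hk
  ·   linear_combination (norm := (field_simp; ring))
        ε * (y 0 + (x 0 * y 0 + x 1 * y 1) / q * x 0 + ε * F * x 1) * hT - ε * (y 0 + (x 0 * y 0 + x 1 * y 1) / q * x 0 + ε * F * x 1) * hH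
        + (ε * (0 + x 1 / q * x 0) + ε ^ 2 * F1 * x 1) * hC
        + (1 - ε * F1 * x 0) / q ^ 2 * hQ
        + (F * (y 1 - ε * F * x 0) * F1 / q - (1 - ε * F1 * x 0) * F ^ 2 / q) * hd
        - (y 1 - ε * F * x 0) / q ^ 2 * hk

end

/-! ### Busemann-Hausdorff volume and S-curvature -/

section

variable {ε : ℝ} {p x y : Coord 2}

theorem randers_lt_one_iff (hp : p ∈ disk ε) :
    randers ε p y < 1 ↔ kq p (y - ε • rot p) < qf p ^ 2 := by
  have hq := qf_pos hp
  have hd := df_pos hp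
  have hQ := randers_quadratic (y := y) hp
  have hM : 0 ≤ df ε p * randers ε p y + ε * cr p y := by
    rw [randers_sqrt hp]; exact Real.sqrt_nonneg _
  have hs := kq_shift (ε := ε) p y 1 one_ne_zero
  rw [inv_one, one_smul] at hs
  -- Subtract the quadratic equation at F from the same quadratic evaluated at 1. In both directions
  -- the last factor is shown to be positive, so the sign is that of 1 - F.
  have hfac : qf p ^ 2 - kq p (y - ε • rot p) = qf p * (1 - randers ε p y) *
      ((df ε p * randers ε p y + ε * cr p y) + (df ε p + ε * cr p y)) := by
    linear_combination hs + hQ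
  constructor
  · intro h
    have h1 : df ε p * randers ε p y < df ε p := by nlinarith
    have : 0 < qf p * (1 - randers ε p y) *
        ((df ε p * randers ε p y + ε * cr p y) + (df ε p + ε * cr p y)) :=
      mul_pos (mul_pos hq (by linarith)) (by linarith)
    linarith
  · intro h
    have hk := kq_nonneg (y := y) hq
    have h1 : 0 < qf p * (df ε p + 2 * ε * cr p y) := by nlinarith
    have h2 : 0 < df ε p + 2 * ε * cr p y := pos_of_mul_pos_right h1 hq.le
    have h3 : 0 < (df ε p * randers ε p y + ε * cr p y) + (df ε p + ε * cr p y) := by linarith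
    have h4 : 0 < qf p * (1 - randers ε p y) :=
      pos_of_mul_pos_left (hfac ▸ sub_pos.mpr h) h3.le
    linarith [pos_of_mul_pos_right h4 hq.le]

/-- A matrix carrying the Klein norm at `p` to the Euclidean norm. -/
def kleinRoot (p : Coord 2) : Matrix (Fin 2) (Fin 2) ℝ :=
  !![Real.sqrt (1 - p 1 ^ 2) / qf p, p 0 * p 1 / Real.sqrt (1 - p 1 ^ 2) / qf p;
    0, Real.sqrt (qf p) / Real.sqrt (1 - p 1 ^ 2) / qf p]

theorem one_sub_sq_pos (hq : 0 < qf p) : 0 < 1 - p 1 ^ 2 := by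
  rw [qf] at hq; nlinarith [sq_nonneg (p 0)]

theorem kleinRoot_det (hq : 0 < qf p) : (kleinRoot p).det = Real.sqrt (qf p) / qf p ^ 2 := by
  have ha := Real.sqrt_pos.mpr (one_sub_sq_pos hq)
  rw [kleinRoot, Matrix.det_fin_two_of]
  field_simp
  ring

/-- `kleinRoot` is a triangular (Cholesky) square root, obtained by completing the square in z 0. It
exhibits the Klein ball as a linear preimage of the Euclidean one, so its area comes from a
determinant. -/
theorem norm_kleinRoot (hq : 0 < qf p) (z : Coord 2) :
    ‖Matrix.toEuclideanLin (kleinRoot p) z‖ ^ 2 = kq p z / qf p ^ 2 := by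
  have ha := Real.sqrt_pos.mpr (one_sub_sq_pos hq)
  have hsq := Real.sq_sqrt (one_sub_sq_pos hq).le
  have hsq2 := Real.sq_sqrt hq.le
  rw [EuclideanSpace.real_norm_sq_eq, Fin.sum_univ_two]
  simp only [Matrix.toLpLin_apply, Matrix.mulVec, dotProduct, Fin.sum_univ_two, kleinRoot,
    Matrix.of_apply, Matrix.cons_val', Matrix.cons_val_zero, Matrix.cons_val_one,
    Matrix.cons_val_fin_one, kq]
  generalize Real.sqrt (1 - p 1 ^ 2) = a at *
  generalize Real.sqrt (qf p) = b at *
  have hb : b ^ 2 = 1 - (p 0 ^ 2 + p 1 ^ 2) := hsq2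
  field_simp
  rw [qf]
  linear_combination (a ^ 2 * z 0 ^ 2 - (1 - p 0 ^ 2) * z 1 ^ 2) * hsq + z 1 ^ 2 * hb

theorem setOf_randers_lt_one (hp : p ∈ disk ε) : {y | randers ε p y < 1} =
    (fun y => y + -(ε • rot p)) ⁻¹'
      (Matrix.toEuclideanLin (kleinRoot p) ⁻¹' Metric.ball (0 : Coord 2) 1) := by
  have hq := qf_pos hp
  ext y
  simp only [Set.mem_ofPred_eq, Set.mem_preimage, mem_ball_zero_iff]
  rw [randers_lt_one_iff hp, ← sq_lt_one_iff₀ (norm_nonneg _), norm_kleinRoot hq,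
    div_lt_one (by positivity), sub_eq_add_neg]

theorem bhDensity_randers (hp : p ∈ disk ε) :
    bhDensity (randers ε) p = Real.sqrt (qf p) / qf p ^ 2 := by
  have hq := qf_pos hp
  have hs := Real.sqrt_pos.mpr hq
  have hdet : LinearMap.det (Matrix.toEuclideanLin (kleinRoot p) : Coord 2 →ₗ[ℝ] Coord 2)
      = Real.sqrt (qf p) / qf p ^ 2 := by
    rw [← kleinRoot_det hq]
    exact LinearMap.det_toLpLin 2 _
  have hb : 0 < (MeasureTheory.volume (Metric.ball (0 : Coord 2) 1)).toReal :=
    ENNReal.toReal_pos (Metric.measure_ball_pos _ _ one_pos).ne' MeasureTheory.measure_ball_lt_top.ne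
  rw [bhDensity, setOf_randers_lt_one hp, MeasureTheory.measure_preimage_add_right,
    MeasureTheory.Measure.addHaar_preimage_linearMap _ (by rw [hdet]; positivity), hdet,
    ENNReal.toReal_mul, ENNReal.toReal_ofReal (abs_nonneg _), abs_of_pos (by positivity)]
  field_simp

theorem bhDensity_randers_hasPd (hx : x ∈ disk ε) (i : Fin 2) :
    HasPd (bhDensity (randers ε)) i (3 * x i / qf x * bhDensity (randers ε) x) x := by
  have hq := qf_pos hx
  have hs := Real.sqrt_pos.mpr hq
  have hsq := Real.sq_sqrt hq.le
  have h := ((HasPd.qf (x := x) i).sqrt hq).div (HasPd.qf i).sq (by positivity)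
  refine (h.congr (g := bhDensity (randers ε)) ?_).congr_val ?_
  · filter_upwards [(isOpen_disk ε).mem_nhds hx] with x' hx' using (bhDensity_randers hx').symm
  · rw [bhDensity_randers hx]
    generalize Real.sqrt (qf x) = s at *
    field_simp
    rw [hsq]
    ring

/-- The trace of G^i_{y^k} is 3P - ε dF(V), since rotations are trace-free and ⟨x, rot x⟩ = 0. The
last term is zero by `randers_dY_rotational`, and the density contributes -3P. -/
theorem sCurv_randers (hx : x ∈ disk ε) (hy : y ≠ 0) : sCurv (randers ε) x y = 0 := by
  have hq := qf_pos hx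
  have hV := randers_dY_rotational hx hy
  have hσ : bhDensity (randers ε) x ≠ 0 := by
    have := Real.sqrt_pos.mpr hq
    rw [bhDensity_randers hx]; positivity
  have hG (i : Fin 2) : pd (fun w => spray (randers ε) x w i) i y
      = dY (randersSpray ε i) i x y :=
    dY_congr (isOpen_slit_disk ε) (mem_slit hx hy) (fun _ _ h =>
      (isSprayOn_randersSpray ε).spray_eq (isFinslerOn_randers ε) (isOpen_disk ε) h.1 h.2 i) i
  simp only [sCurv, hG, (bhDensity_randers_hasPd hx _).eq, Fin.sum_univ_two,
    dY_randersSpray hx hy]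
  simp
  unfold kp at *
  generalize bhDensity (randers ε) x = σ at *
  linear_combination (norm := (field_simp; ring)) -ε * hV

end

/-! ### Geodesics through the origin and failure of projective flatness -/

section

variable {ε : ℝ}

theorem hasDerivAt_tanh (t : ℝ) : HasDerivAt Real.tanh (1 - Real.tanh t ^ 2) t := by
  have hc := (Real.cosh_pos t).ne'
  have h := (Real.hasDerivAt_sinh t).div (Real.hasDerivAt_cosh t) hc
  rw [show Real.tanh = Real.sinh / Real.cosh from
    funext fun t => Real.tanh_eq_sinh_div_cosh t]
  refine h.congr_deriv ?_
  simp only [Pi.div_apply]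
  field_simp

theorem contDiff_tanh : ContDiff ℝ ∞ Real.tanh := by
  rw [show Real.tanh = fun t => Real.sinh t / Real.cosh t from
    funext fun t => Real.tanh_eq_sinh_div_cosh t]
  exact Real.contDiff_sinh.div Real.contDiff_cosh fun t => (Real.cosh_pos t).ne'

/-- The geodesics of `randers ε` through the origin: rotated geodesics of the Klein metric. -/
def spiral (ε θ t : ℝ) : Coord 2 :=
  (Real.tanh t * Real.cos (ε * t + θ)) • e 0 + (Real.tanh t * Real.sin (ε * t + θ)) • e 1

/-- The velocity of `spiral`. -/
def spiralVel (ε θ t : ℝ) : Coord 2 :=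
  ((1 - Real.tanh t ^ 2) * Real.cos (ε * t + θ) - ε * Real.tanh t * Real.sin (ε * t + θ)) • e 0
    + ((1 - Real.tanh t ^ 2) * Real.sin (ε * t + θ)
      + ε * Real.tanh t * Real.cos (ε * t + θ)) • e 1

/-- The acceleration of `spiral`. -/
def spiralAcc (ε θ t : ℝ) : Coord 2 :=
  (-2 * Real.tanh t * (1 - Real.tanh t ^ 2) * Real.cos (ε * t + θ)
      - 2 * ε * (1 - Real.tanh t ^ 2) * Real.sin (ε * t + θ)
      - ε ^ 2 * Real.tanh t * Real.cos (ε * t + θ)) • e 0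
    + (-2 * Real.tanh t * (1 - Real.tanh t ^ 2) * Real.sin (ε * t + θ)
      + 2 * ε * (1 - Real.tanh t ^ 2) * Real.cos (ε * t + θ)
      - ε ^ 2 * Real.tanh t * Real.sin (ε * t + θ)) • e 1

theorem hasDerivAt_phase (ε θ t : ℝ) : HasDerivAt (fun t => ε * t + θ) ε t := by
  simpa using ((hasDerivAt_id t).const_mul ε).add_const θ

theorem hasDerivAt_spiral (ε θ t : ℝ) : HasDerivAt (spiral ε θ) (spiralVel ε θ t) t := by
  have hT := hasDerivAt_tanh t
  have hp := hasDerivAt_phase ε θ t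
  refine (((hT.mul hp.cos).smul_const (e (0 : Fin 2))).add
    ((hT.mul hp.sin).smul_const (e (1 : Fin 2)))).congr_deriv ?_
  rw [spiralVel]
  congr 2 <;> ring

theorem hasDerivAt_spiralVel (ε θ t : ℝ) : HasDerivAt (spiralVel ε θ) (spiralAcc ε θ t) t := by
  have hT := hasDerivAt_tanh t
  have hp := hasDerivAt_phase ε θ t
  have hS := (hT.pow 2).const_sub 1
  refine ((((hS.mul hp.cos).sub ((hT.const_mul ε).mul hp.sin)).smul_const (e (0 : Fin 2))).add
    (((hS.mul hp.sin).add ((hT.const_mul ε).mul hp.cos)).smul_const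
      (e (1 : Fin 2)))).congr_deriv ?_
  rw [spiralAcc]
  congr 2 <;> simp <;> ring

theorem contDiff_spiral (ε θ : ℝ) : ContDiff ℝ ∞ (spiral ε θ) := by
  have := contDiff_tanh
  unfold spiral
  fun_prop

theorem qf_spiral (ε θ t : ℝ) : qf (spiral ε θ t) = 1 - Real.tanh t ^ 2 := by
  have := Real.sin_sq_add_cos_sq (ε * t + θ)
  simp [qf, spiral]
  linear_combination Real.tanh t ^ 2 * this

theorem spiralVel_ne_zero (ε θ t : ℝ) (h : 0 < 1 - Real.tanh t ^ 2) : spiralVel ε θ t ≠ 0 := by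
  intro h0
  have e0 : spiralVel ε θ t 0 = 0 := by rw [h0]; rfl
  have e1 : spiralVel ε θ t 1 = 0 := by rw [h0]; rfl
  have hsc := Real.sin_sq_add_cos_sq (ε * t + θ)
  have : (1 - Real.tanh t ^ 2) ^ 2 + (ε * Real.tanh t) ^ 2
      = spiralVel ε θ t 0 ^ 2 + spiralVel ε θ t 1 ^ 2 := by
    simp [spiralVel]
    linear_combination (-(1 - Real.tanh t ^ 2) ^ 2 - (ε * Real.tanh t) ^ 2) * hsc
  rw [e0, e1] at this
  have h2 : 0 < (1 - Real.tanh t ^ 2) ^ 2 := by positivity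
  nlinarith [sq_nonneg (ε * Real.tanh t)]

/-- Removing the drift ε rot from the velocity leaves the radial vector of length 1 - tanh² t, which
has Klein norm 1; uniqueness in the navigation equation then gives F = 1. -/
theorem randers_spiralVel (θ t : ℝ) (h : spiral ε θ t ∈ disk ε) :
    randers ε (spiral ε θ t) (spiralVel ε θ t) = 1 := by
  have hq := qf_pos h
  have hq' := hq
  rw [qf_spiral] at hq'
  symm
  rw [← randers_unique h (spiralVel_ne_zero ε θ t hq') one_pos, kleinNorm_eq_one_iff hq, kq,
    qf_spiral]
  have hsc := Real.sin_sq_add_cos_sq (ε * t + θ)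
  simp [spiral, spiralVel]
  ring_nf
  have hs : Real.sin (ε * t + θ) ^ 2 = 1 - Real.cos (ε * t + θ) ^ 2 := by linarith
  have hs4 : Real.sin (ε * t + θ) ^ 4 = (1 - Real.cos (ε * t + θ) ^ 2) ^ 2 := by rw [← hs]; ring
  rw [hs4, hs]
  ring

theorem isGeodesicIn_spiral {V : Set (Coord 2)} (hV : V ⊆ disk ε) (θ : ℝ) {a b : ℝ}
    (h : ∀ t ∈ Set.Ioo a b, spiral ε θ t ∈ V) :
    IsGeodesicIn (randers ε) V a b (spiral ε θ) := by
  have hd : deriv (spiral ε θ) = spiralVel ε θ := funext fun t => (hasDerivAt_spiral ε θ t).deriv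
  have hq (t : ℝ) (ht : t ∈ Set.Ioo a b) : 0 < 1 - Real.tanh t ^ 2 := by
    rw [← qf_spiral ε θ t]; exact qf_pos (hV (h t ht))
  refine ⟨((contDiff_spiral ε θ).of_le (WithTop.coe_le_coe.2 (le_top : (2 : ℕ∞) ≤ ⊤))).contDiffOn, h, fun t ht => ?_,
    fun t ht i => ?_⟩
  · rw [hd]; exact spiralVel_ne_zero ε θ t (hq t ht)
  · rw [hd, (hasDerivAt_spiralVel ε θ t).deriv, (isSprayOn_randersSpray ε).spray_eq
      (isFinslerOn_randers ε) (isOpen_disk ε) (hV (h t ht)) (spiralVel_ne_zero ε θ t (hq t ht)),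
      randersSpray, randers_spiralVel θ t (hV (h t ht))]
    have hsc := Real.sin_sq_add_cos_sq (ε * t + θ)
    have hP : kp (spiral ε θ t) (spiralVel ε θ t) = Real.tanh t := by
      rw [kp, qf_spiral, div_eq_iff (hq t ht).ne']
      simp [spiral, spiralVel]
      linear_combination (Real.tanh t * (1 - Real.tanh t ^ 2)) * hsc
    rw [hP]
    fin_cases i <;> simp [spiral, spiralVel, spiralAcc] <;> ring

/-- The area form with its first argument fixed, as a continuous linear functional. -/
def crL (u : Coord 2) : Coord 2 →L[ℝ] ℝ :=
  u 0 • EuclideanSpace.proj 1 - u 1 • EuclideanSpace.proj 0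

theorem crL_apply (u v : Coord 2) : crL u v = cr u v := by simp [crL, cr]

theorem exists_smul_of_cr_eq_zero {u v : Coord 2} (hu : u ≠ 0) (h : cr u v = 0) :
    ∃ l : ℝ, v = l • u := by
  have hpos := (sq_add_sq_pos hu).ne'
  rw [cr] at h
  refine ⟨(u 0 * v 0 + u 1 * v 1) / (u 0 ^ 2 + u 1 ^ 2), ?_⟩
  ext i
  fin_cases i <;> simp <;> field_simp
  · linear_combination (-u 1) * h
  · linear_combination u 0 * h

/-- A collinear curve stays on its tangent line. -/
theorem cr_eq_zero_of_collinear {c : ℝ → Coord 2} {δ : ℝ} (hδ : 0 < δ) {w : Coord 2}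
    (hc : HasDerivAt c w 0) (hcol : Collinear ℝ (c '' Set.Ioo (-δ) δ)) :
    ∀ t ∈ Set.Ioo (-δ) δ, cr w (c t - c 0) = 0 := by
  have h0 : (0 : ℝ) ∈ Set.Ioo (-δ) δ := ⟨by linarith, hδ⟩
  obtain ⟨v, hv⟩ := (collinear_iff_of_mem (Set.mem_image_of_mem c h0)).mp hcol
  have hcr (t : ℝ) (ht : t ∈ Set.Ioo (-δ) δ) : ∃ r : ℝ, c t - c 0 = r • v := by
    obtain ⟨r, hr⟩ := hv (c t) (Set.mem_image_of_mem c ht)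
    exact ⟨r, by rw [hr]; simp⟩
  -- A functional that vanishes on the direction of the line is constant along the curve, so it
  -- kills the velocity. Taking u = v shows that w is parallel to v.
  have hlin (u : Coord 2) (hu : cr u v = 0) : cr u w = 0 := by
    have h1 : HasDerivAt (fun t => crL u (c t - c 0)) (crL u w) 0 :=
      (crL u).hasFDerivAt.comp_hasDerivAt (0 : ℝ) (hc.sub_const (c 0))
    have h2 : HasDerivAt (fun t => crL u (c t - c 0)) 0 0 := by
      refine (hasDerivAt_const (0 : ℝ) (0 : ℝ)).congr_of_eventuallyEq ?_
      filter_upwards [Ioo_mem_nhds h0.1 h0.2] with t ht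
      obtain ⟨r, hr⟩ := hcr t ht
      rw [hr, map_smul, crL_apply, hu, smul_zero]
    rw [← crL_apply]
    exact h1.unique h2
  have hvw : cr v w = 0 := hlin v (by rw [cr]; ring)
  intro t ht
  obtain ⟨r, hr⟩ := hcr t ht
  rw [hr]
  have : cr w (r • v) = -r * cr v w := by simp [cr]; ring
  rw [this, hvw, mul_zero]

theorem spiral_zero (ε θ : ℝ) : spiral ε θ 0 = 0 := by simp [spiral]

theorem spiralVel_zero (ε : ℝ) : spiralVel ε 0 0 = e 0 := by simp [spiralVel]

theorem spiral_pi (ε t : ℝ) : spiral ε Real.pi t = -spiral ε 0 t := by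
  simp [spiral, Real.cos_add_pi, Real.sin_add_pi]
  abel

theorem spiralVel_pi_zero (ε : ℝ) : spiralVel ε Real.pi 0 = -e 0 := by simp [spiralVel]

/-- The spirals with phases 0 and π, the second run backwards, are mirror images in the first axis,
so their separation is exactly along `e 1`. -/
theorem spiral_add_spiral_neg (ε t : ℝ) :
    spiral ε 0 t - -spiral ε 0 (-t) = (2 * Real.tanh t * Real.sin (ε * t)) • e 1 := by
  simp [spiral, Real.tanh_neg]
  module

/-- If φ straightens geodesics, the functional z ↦ dφ(e₀) × φ(z) takes the same value on both
spirals tangent to ± e₀. Their separation is a nonzero multiple of e₁, so strict differentiability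
at 0 forces dφ(e₀) × dφ(e₁) = 0, against the invertibility of dφ. -/
theorem not_isLocallyProjectivelyFlatOn_randers (hε : ε ≠ 0) :
    ¬ IsLocallyProjectivelyFlatOn (disk ε) (randers ε) := by
  intro h
  obtain ⟨φ, h0, hsub, hφ, hφs, hgeo⟩ := h 0 (zero_mem_disk ε)
  have hnhds : φ.source ∈ 𝓝 (0 : Coord 2) := φ.open_source.mem_nhds h0
  have hstr : HasStrictFDerivAt φ (fderiv ℝ φ 0) 0 :=
    (hφ.contDiffAt hnhds).hasStrictFDerivAt (by simp)
  set A := fderiv ℝ φ 0 with hA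
  have hinv (v : Coord 2) (hv : A v = 0) : v = 0 := by
    have hs : DifferentiableAt ℝ φ.symm (φ 0) :=
      (hφs.contDiffAt (φ.open_target.mem_nhds (φ.map_source h0))).differentiableAt (by simp)
    have h1 := hs.hasFDerivAt.comp (0 : Coord 2) hstr.hasFDerivAt
    have h2 : HasFDerivAt (φ.symm ∘ φ) (ContinuousLinearMap.id ℝ (Coord 2)) 0 :=
      (hasFDerivAt_id (0 : Coord 2)).congr_of_eventuallyEq
        (by filter_upwards [hnhds] with z hz using φ.left_inv hz)
    have h3 := congrArg (fun L : Coord 2 →L[ℝ] Coord 2 => L v) (h1.unique h2)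
    simpa [hv] using h3.symm
  have he (i : Fin 2) : (e i : Coord 2) ≠ 0 := fun h => by
    have := congrArg (fun v : Coord 2 => v i) h
    simp at this
  have hu : A (e 0) ≠ 0 := fun h => he 0 (hinv _ h)
  -- `φ` maps the two geodesics tangent to `± e 0` into the same line
  have hline (θ : ℝ) :
      ∀ᶠ t in 𝓝 (0 : ℝ), cr (A (spiralVel ε θ 0)) (φ (spiral ε θ t) - φ 0) = 0 := by
    have hcont : ContinuousAt (spiral ε θ) 0 := (hasDerivAt_spiral ε θ 0).continuousAt
    have hev : ∀ᶠ t in 𝓝 (0 : ℝ), spiral ε θ t ∈ φ.source :=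
      hcont.eventually (by rw [spiral_zero]; exact hnhds)
    obtain ⟨δ, hδ, hball⟩ := Metric.eventually_nhds_iff_ball.mp hev
    rw [Real.ball_eq_Ioo, zero_sub, zero_add] at hball
    have hcol := hgeo (-δ) δ _ (isGeodesicIn_spiral hsub θ hball)
    have hd : HasDerivAt (fun t => φ (spiral ε θ t)) (A (spiralVel ε θ 0)) 0 := by
      have hf : HasFDerivAt φ A (spiral ε θ 0) := by
        rw [spiral_zero]; exact hstr.hasFDerivAt
      exact hf.comp_hasDerivAt (0 : ℝ) (hasDerivAt_spiral ε θ 0)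
    have hz := cr_eq_zero_of_collinear hδ hd hcol
    rw [spiral_zero] at hz
    filter_upwards [Ioo_mem_nhds (neg_lt_zero.mpr hδ) hδ] with t ht using hz t ht
  have hp : ∀ᶠ t in 𝓝 (0 : ℝ), cr (A (e 0)) (φ (spiral ε 0 t) - φ 0) = 0 := by
    simpa [spiralVel_zero] using hline 0
  have hm : ∀ᶠ t in 𝓝 (0 : ℝ), cr (A (e 0)) (φ (-spiral ε 0 t) - φ 0) = 0 := by
    filter_upwards [hline Real.pi] with t ht
    rw [spiralVel_pi_zero, spiral_pi, map_neg] at ht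
    simp only [cr, PiLp.neg_apply] at ht ⊢
    linarith
  have hm' : ∀ᶠ t in 𝓝 (0 : ℝ), cr (A (e 0)) (φ (-spiral ε 0 (-t)) - φ 0) = 0 := by
    have : Tendsto (fun t : ℝ => -t) (𝓝 0) (𝓝 0) := by
      simpa using (continuous_neg (G := ℝ)).tendsto 0
    exact this.eventually hm
  -- Strictness is essential: both points move with t, and the error must be small relative to their
  -- separation, which is of second order in t.
  have hg : HasStrictFDerivAt (fun z => crL (A (e 0)) (φ z)) ((crL (A (e 0))).comp A) 0 :=
    (crL (A (e 0))).hasStrictFDerivAt.comp (0 : Coord 2) hstr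
  have htend : Tendsto (fun t : ℝ => (spiral ε 0 t, -spiral ε 0 (-t))) (𝓝 0)
      (𝓝 ((0 : Coord 2), (0 : Coord 2))) := by
    have hc : Continuous (spiral ε 0) := (contDiff_spiral ε 0).continuous
    have : Continuous (fun t : ℝ => (spiral ε 0 t, -spiral ε 0 (-t))) := by fun_prop
    simpa [spiral_zero] using this.tendsto 0
  have hlit := hg.isLittleO.comp_tendsto htend
  have hzero : cr (A (e 0)) (A (e 1)) = 0 := by
    by_contra hne
    have hev := hlit.def (half_pos (abs_pos.mpr hne))
    -- For such t both tanh t and sin(εt) are nonzero, so the two points are distinct.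
    have hsmall : ∀ᶠ t in 𝓝[>] (0 : ℝ), 0 < t ∧ |ε * t| < Real.pi := by
      refine eventually_mem_nhdsWithin.and (Filter.Eventually.filter_mono nhdsWithin_le_nhds ?_)
      have : ContinuousAt (fun t : ℝ => |ε * t|) 0 := by fun_prop
      exact this.eventually (gt_mem_nhds (by simpa using Real.pi_pos))
    obtain ⟨t, ⟨ht0, htp⟩, ht1, ht2, ht3⟩ := (hsmall.and
      ((hev.and (hp.and hm')).filter_mono nhdsWithin_le_nhds)).exists
    have hT : Real.tanh t ≠ 0 := by
      rw [Real.tanh_eq_sinh_div_cosh]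
      exact div_ne_zero (Real.sinh_ne_zero.mpr ht0.ne') (Real.cosh_pos t).ne'
    have hsin : Real.sin (ε * t) ≠ 0 := by
      rw [Ne, Real.sin_eq_zero_iff_of_lt_of_lt (abs_lt.mp htp).1 (abs_lt.mp htp).2]
      exact mul_ne_zero hε ht0.ne'
    have hcr (z : Coord 2) (hz : cr (A (e 0)) (φ z - φ 0) = 0) :
        crL (A (e 0)) (φ z) = crL (A (e 0)) (φ 0) := by
      rwa [← crL_apply, map_sub, sub_eq_zero] at hz
    have hne1 : ‖(e 1 : Coord 2)‖ = 1 := by simp [e]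
    simp only [Function.comp_apply, spiral_add_spiral_neg, hcr _ ht2, hcr _ ht3, sub_self,
      zero_sub, norm_neg, ContinuousLinearMap.comp_apply, map_smul, norm_smul, hne1, mul_one,
      norm_mul] at ht1
    rw [crL_apply] at ht1
    rw [← Real.norm_eq_abs] at ht1
    have hpos : 0 < ‖(2 : ℝ)‖ * ‖Real.tanh t‖ * ‖Real.sin (ε * t)‖ :=
      mul_pos (mul_pos (by norm_num) (norm_pos_iff.mpr hT)) (norm_pos_iff.mpr hsin)
    have hpos2 : 0 < ‖cr (A (e 0)) (A (e 1))‖ := norm_pos_iff.mpr hne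
    nlinarith [mul_pos hpos hpos2]
  obtain ⟨l, hl⟩ := exists_smul_of_cr_eq_zero hu hzero
  have h1 := hinv (e 1 - l • e 0) (by rw [map_sub, map_smul, hl, sub_self])
  have := congrArg (fun v : Coord 2 => v 1) h1
  simp at this

end

/-! ### The Gauss curvature of α -/

section

variable {ε : ℝ} {x : Coord 2}

/-- Rotational symmetry gives the form a δ_ij + b x_i x_j with a and b functions of |x|². This shape
passes to the inverse and keeps the formula for the Christoffel symbols uniform in the indices. -/
theorem alphaCoeff_eq_radial (hx : x ∈ disk ε) (i j : Fin 2) :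
    alphaCoeff ε x i j = qf x / df ε x ^ 2 * e i j
      + (qf x - ε ^ 2) / (qf x * df ε x ^ 2) * (x i * x j) := by
  have hq := (qf_pos hx).ne'
  have hd := (df_pos hx).ne'
  rw [alphaCoeff_eq hx]
  field_simp
  fin_cases i <;> fin_cases j <;> simp [radCoeff] <;> field_simp <;>
    simp only [qf, df] <;> ring

theorem alphaCoeff_det (hx : x ∈ disk ε) : (alphaCoeff ε x).det = 1 / df ε x ^ 3 := by
  have hd := (df_pos hx).ne'
  have hs : radCoeff ε x 1 0 = radCoeff ε x 0 1 := rfl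
  have h := radCoeff_det (ε := ε) (qf_pos hx).ne'
  rw [Matrix.det_fin_two, alphaCoeff_eq hx, alphaCoeff_eq hx, alphaCoeff_eq hx,
    alphaCoeff_eq hx, hs]
  field_simp
  linear_combination h

/-- The inverse of the metric `alphaCoeff`. -/
def alphaInv (ε : ℝ) (x : Coord 2) : Matrix (Fin 2) (Fin 2) ℝ :=
  Matrix.of fun k l => df ε x ^ 2 / qf x * e k l
    - df ε x * (qf x - ε ^ 2) / qf x * (x k * x l)

theorem alphaCoeff_inv (hx : x ∈ disk ε) : (alphaCoeff ε x)⁻¹ = alphaInv ε x := by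
  have hq := (qf_pos hx).ne'
  have hd := (df_pos hx).ne'
  refine Matrix.inv_eq_right_inv ?_
  ext i j
  simp only [Matrix.mul_apply, Fin.sum_univ_two, alphaCoeff_eq_radial hx, alphaInv,
    Matrix.of_apply]
  fin_cases i <;> fin_cases j <;> simp <;> field_simp <;> simp only [qf, df] <;> ring

theorem alphaCoeff_hasPd (hx : x ∈ disk ε) (i j k : Fin 2) :
    HasPd (fun x => alphaCoeff ε x i j) k
      (x k * (4 * (1 + ε ^ 2) * qf x - 2 * df ε x) / df ε x ^ 3 * e i j
        + 2 * x k * ((qf x - ε ^ 2) * (df ε x + 2 * (1 + ε ^ 2) * qf x) - qf x * df ε x)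
          / (qf x ^ 2 * df ε x ^ 3) * (x i * x j)
        + (qf x - ε ^ 2) / (qf x * df ε x ^ 2) * (e k i * x j + x i * e k j)) x := by
  have hq := (qf_pos hx).ne'
  have hd := (df_pos hx).ne'
  have hQ := HasPd.qf (x := x) k
  have hD := HasPd.df (ε := ε) (x := x) k
  have h := ((hQ.div hD.sq (pow_ne_zero 2 hd)).mul (HasPd.const (e i j))).add
    (((hQ.sub (HasPd.const (ε ^ 2))).div (hQ.mul hD.sq)
      (mul_ne_zero hq (pow_ne_zero 2 hd))).mul ((HasPd.coord_e k i).mul (HasPd.coord_e k j)))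
  refine (h.congr (g := fun x => alphaCoeff ε x i j) ?_).congr_val ?_
  · filter_upwards [(isOpen_disk ε).mem_nhds hx] with x' hx' using
      (alphaCoeff_eq_radial hx' i j).symm
  · field_simp
    ring

/-- The Christoffel symbols of `alphaCoeff`. -/
def alphaGamma (ε : ℝ) (k i j : Fin 2) (x : Coord 2) : ℝ :=
  (2 * (1 + ε ^ 2) * qf x - df ε x) / (qf x * df ε x) * (x i * e j k + x j * e i k)
    - ε ^ 2 * ((2 * qf x + df ε x) / df ε x ^ 2 * (e i j * x k))
    - ε ^ 2 * ((df ε x + 2 * qf x - 2 * ε ^ 2) / (qf x * df ε x ^ 2) * (x i * x j * x k))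

theorem christoffel_alphaCoeff (hx : x ∈ disk ε) (k i j : Fin 2) :
    christoffel (alphaCoeff ε) k i j x = alphaGamma ε k i j x := by
  have hq := (qf_pos hx).ne'
  have hd := (df_pos hx).ne'
  simp only [christoffel, alphaCoeff_inv hx, (alphaCoeff_hasPd hx _ _ _).eq, Fin.sum_univ_two,
    alphaInv, Matrix.of_apply, alphaGamma]
  fin_cases k <;> fin_cases i <;> fin_cases j <;> simp <;> field_simp <;>
    simp only [qf, df] <;> ring

theorem alphaGamma_hasPd (hx : x ∈ disk ε) (k i j l : Fin 2) :
    HasPd (christoffel (alphaCoeff ε) k i j) l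
      (x l * (4 * (1 + ε ^ 2) ^ 2 / df ε x ^ 2 - 2 / qf x ^ 2) * (x i * e j k + x j * e i k)
        + (2 * (1 + ε ^ 2) * qf x - df ε x) / (qf x * df ε x) * (e l i * e j k + e l j * e i k)
        - ε ^ 2 * (x l * (8 * (1 + ε ^ 2) * qf x / df ε x ^ 3 + (2 * (1 + ε ^ 2) - 4) / df ε x ^ 2)
            * (e i j * x k)
          + (2 * qf x + df ε x) / df ε x ^ 2 * (e i j * e l k))
        - ε ^ 2 * (x l * ((df ε x + 2 * qf x - 2 * ε ^ 2) * (2 * df ε x + 4 * (1 + ε ^ 2) * qf x)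
            - (2 * (1 + ε ^ 2) + 4) * (qf x * df ε x)) / (qf x ^ 2 * df ε x ^ 3)
              * (x i * x j * x k)
          + (df ε x + 2 * qf x - 2 * ε ^ 2) / (qf x * df ε x ^ 2)
            * ((e l i * x j + x i * e l j) * x k + x i * x j * e l k))) x := by
  have hq := (qf_pos hx).ne'
  have hd := (df_pos hx).ne'
  have hQ := HasPd.qf (x := x) l
  have hD := HasPd.df (ε := ε) (x := x) l
  have hi := HasPd.coord_e (x := x) l i
  have hj := HasPd.coord_e (x := x) l j
  have hk := HasPd.coord_e (x := x) l k
  have h1 := (((hQ.const_mul (2 * (1 + ε ^ 2))).sub hD).div (hQ.mul hD) (mul_ne_zero hq hd)).mul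
    ((hi.mul (HasPd.const (e j k))).add (hj.mul (HasPd.const (e i k))))
  have h2 := ((((hQ.const_mul 2).add hD).div hD.sq (pow_ne_zero 2 hd)).mul
    (hk.const_mul (e i j))).const_mul (ε ^ 2)
  have h3 := ((((hD.add (hQ.const_mul 2)).sub (HasPd.const (2 * ε ^ 2))).div (hQ.mul hD.sq)
    (mul_ne_zero hq (pow_ne_zero 2 hd))).mul ((hi.mul hj).mul hk)).const_mul (ε ^ 2)
  refine (((h1.sub h2).sub h3).congr (g := christoffel (alphaCoeff ε) k i j) ?_).congr_val ?_
  · filter_upwards [(isOpen_disk ε).mem_nhds hx] with x' hx' using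
      (christoffel_alphaCoeff hx' k i j).symm
  · congr 1
    · congr 1
      · field_simp; ring
      · field_simp; ring
    · field_simp; ring

/-- The Gauss curvature of `α`. -/
def alphaGauss (ε : ℝ) (x : Coord 2) : ℝ :=
  -(1 + 5 * ε ^ 2 + (1 + ε ^ 2) * (ε ^ 2 - 1) * (x 0 ^ 2 + x 1 ^ 2)) / df ε x

/-- On a surface R(∂₀, ∂₁)∂₁ = K (a₁₁ ∂₀ - a₀₁ ∂₁); this is the ∂₀ component, and the next lemma is
the other one. Lowering the index turns K times the bracket into K det a. -/
theorem curvTensor_alphaCoeff_zero (hx : x ∈ disk ε) :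
    curvTensor (alphaCoeff ε) 0 1 0 1 x = alphaGauss ε x * alphaCoeff ε x 1 1 := by
  have hq := (qf_pos hx).ne'
  have hd := (df_pos hx).ne'
  simp only [curvTensor, (alphaGamma_hasPd hx _ _ _ _).eq, christoffel_alphaCoeff hx,
    Fin.sum_univ_two, alphaGamma, alphaGauss, alphaCoeff_eq_radial hx]
  simp
  field_simp
  simp only [qf, df]
  ring

theorem curvTensor_alphaCoeff_one (hx : x ∈ disk ε) :
    curvTensor (alphaCoeff ε) 1 1 0 1 x = -(alphaGauss ε x * alphaCoeff ε x 0 1) := by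
  have hq := (qf_pos hx).ne'
  have hd := (df_pos hx).ne'
  simp only [curvTensor, (alphaGamma_hasPd hx _ _ _ _).eq, christoffel_alphaCoeff hx,
    Fin.sum_univ_two, alphaGamma, alphaGauss, alphaCoeff_eq_radial hx]
  simp
  field_simp
  simp only [qf, df]
  ring

theorem gaussCurv_alphaCoeff (hx : x ∈ disk ε) :
    gaussCurv (alphaCoeff ε) x = alphaGauss ε x := by
  have hd := (df_pos hx).ne'
  have hdet : (alphaCoeff ε x).det ≠ 0 := by rw [alphaCoeff_det hx]; positivity
  have hs : alphaCoeff ε x 1 0 = alphaCoeff ε x 0 1 := by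
    rw [alphaCoeff_eq hx, alphaCoeff_eq hx]; rfl
  rw [gaussCurv, Fin.sum_univ_two, curvTensor_alphaCoeff_zero hx, curvTensor_alphaCoeff_one hx,
    div_eq_iff hdet, Matrix.det_fin_two, hs]
  ring

theorem gaussCurv_alphaCoeff_zero (hx : x ∈ disk 0) : gaussCurv (alphaCoeff 0) x = -1 := by
  have hd := (df_pos hx).ne'
  rw [gaussCurv_alphaCoeff hx, alphaGauss, div_eq_iff hd, df]
  ring

theorem not_const_gaussCurv_alphaCoeff (hε : ε ≠ 0) :
    ¬ ∃ k : ℝ, ∀ p ∈ disk ε, gaussCurv (alphaCoeff ε) p = k := by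
  rintro ⟨k, hk⟩
  have hc : 0 < 1 + ε ^ 2 := by positivity
  obtain ⟨r, hr0, hr⟩ : ∃ r : ℝ, 0 < r ^ 2 ∧ (1 + ε ^ 2) * r ^ 2 < 1 := by
    -- Any nonzero radius inside the disk serves to compare with the curvature -(1 + 5ε²) at the
    -- origin.
    refine ⟨1 / (2 * (1 + ε ^ 2)), by positivity, ?_⟩
    rw [div_pow, one_pow, mul_one_div, div_lt_one (by positivity)]
    nlinarith [sq_nonneg ε]
  have hp : r • e 0 ∈ disk ε := by
    rw [mem_disk_iff, df]
    simpa using hr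
  have h0 := hk 0 (zero_mem_disk ε)
  have h1 := hk _ hp
  rw [gaussCurv_alphaCoeff (zero_mem_disk ε)] at h0
  rw [gaussCurv_alphaCoeff hp, ← h0, alphaGauss, alphaGauss, div_eq_iff (df_pos hp).ne'] at h1
  simp [df] at h1
  -- The coefficient of (1 + ε²) r² is (ε² - 1) + (1 + 5ε²) = 6ε².
  have : 6 * (ε ^ 2 * (1 + ε ^ 2) * r ^ 2) = 0 := by linarith
  have h2 : 0 < ε ^ 2 * (1 + ε ^ 2) * r ^ 2 := by positivity
  linarith

end

end Finsler

end

theorem theorem2 (ε : ℝ) :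
    -- `F` is the unique positive solution of `Φ (y / F - ε v) = 1`
    (∀ p ∈ Finsler.disk ε, ∀ y : Finsler.Coord 2, y ≠ 0 → ∀ t : ℝ, 0 < t →
      (Finsler.kleinNorm p (t⁻¹ • y - ε • Finsler.rot p) = 1 ↔ t = Finsler.randers ε p y)) ∧
    -- `F` is a Finsler metric, of Randers type
    Finsler.IsFinslerOn (Finsler.disk ε) (Finsler.randers ε) ∧
    Finsler.IsRandersOn (Finsler.disk ε) (Finsler.alphaCoeff ε) (Finsler.betaCoeff ε)
      (Finsler.alpha ε) (Finsler.beta ε) (Finsler.randers ε) ∧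
    -- (a) `K = -1`
    Finsler.HasConstCurvatureOn (Finsler.disk ε) (Finsler.randers ε) (-1) ∧
    -- (b) `S = 0`
    (∀ p ∈ Finsler.disk ε, ∀ y : Finsler.Coord 2, y ≠ 0 →
      Finsler.sCurv (Finsler.randers ε) p y = 0) ∧
    -- (c) not locally projectively flat
    (ε ≠ 0 → ¬ Finsler.IsLocallyProjectivelyFlatOn (Finsler.disk ε) (Finsler.randers ε)) ∧
    -- (d) the Gauss curvature of `α`
    (ε ≠ 0 → ¬ ∃ k : ℝ, ∀ p ∈ Finsler.disk ε, Finsler.gaussCurv (Finsler.alphaCoeff ε) p = k) ∧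
    (ε = 0 → ∀ p ∈ Finsler.disk ε, Finsler.gaussCurv (Finsler.alphaCoeff ε) p = -1) := by
  exact ⟨fun p hp y hy t ht => Finsler.randers_unique hp hy ht, Finsler.isFinslerOn_randers ε,
    Finsler.isRandersOn_randers ε, Finsler.hasConstCurvatureOn_randers ε,
    fun p hp y hy => Finsler.sCurv_randers hp hy,
    Finsler.not_isLocallyProjectivelyFlatOn_randers, Finsler.not_const_gaussCurv_alphaCoeff,
    fun h p hp => by subst h; exact Finsler.gaussCurv_alphaCoeff_zero hp⟩
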